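/- Let $\Psi$ be a stationary marked point process in $\mathbb R^2$ with real marks, with corresponding simple unmarked point process $\Phi$, following the geostatistical marking model: the mark of each point $x\in\Phi$ is $Z_1(x)$ for a random field $Z_1$ on $\mathbb R^2$. Let the covariate be a random field $Z_2$ on $\mathbb R^2$. Assume that $\Phi$, $Z_1$, $Z_2$ are mutually independent (in the sense that they are measurable with respect to independent $\sigma$-algebras, the fields being jointly measurable in the location and the random element). Assume that the product densities of $\Phi$ of orders one to four, denoted by $\lambda$ (a constant, the intensity), $\lambda_2,\lambda_3,\lambda_4$, exist and are bounded from above and from below by finite positive constants. Let $Z_1$ and $Z_2$ be identically distributed centred stationary Gaussian random fields with a non-negative covariance function $C$, i.e. $\operatorname{cov}(Z_i(u),Z_i(v))=C(u-v)\ge 0$. Assume that there is a constant $R$ such that $C(u-v)=0$ for $\|u-v\|>R$, and that there are $\delta>0$ and $r>0$ such that $C(u-v)\ge\delta$ for $\|u-v\|\le r$. For a compact observation window $W\subset\mathbb R^2$ of area $|W|>0$ let $$S=\sum_{x,y\in\Phi\cap W}^{\neq}\operatorname{sgn}(Z_1(x)-Z_1(y))\,\operatorname{sgn}(Z_2(x)-Z_2(y)),\qquad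 U=\Phi(W)(\Phi(W)-1),$$ where the sum is over ordered pairs of distinct points, so that $S/U$ is Kendall's rank correlation coefficient $T_K$. Then $\mathbb E S^2<\infty$, $\mathbb E|U|<\infty$, and there exist constants $0<c_1\le c_2<\infty$, $0<d_1\le d_2<\infty$ and $0<u_1\le u_2<\infty$, depending on $\Phi$, $Z_1$, $Z_2$ but not on $W$, such that for every such $W$ one has $\operatorname{var}(S)=A+B$ with $$c_1\le\frac{A}{\lambda^3|W|^3}\le c_2,\qquad d_1\le\frac{B}{\lambda^2|W|^2}\le d_2,\qquad\text{and}\qquad u_1\le\frac{\mathbb E U}{(\lambda|W|)^2}\le u_2 .$$ Moreover, the first-order (Taylor) approximation of the variance of $T_K=S/U$, i.e. the variance of the first-order Taylor polynomial of $(s,u)\mapsto s/u$ at $(\mathbb E S,\mathbb E U)$ evaluated at $(S,U)$, equals $$\frac{\operatorname{var}(S)}{(\mathbb E U)^2}.$$ Hence $\operatorname{var}(T_K)$ is, in this first-order approximation, of order $1/(\lambda|W|)$: for every $w_0>0$ there are constants $0<v_1\le v_2<\infty$, not depending on $W$, such that for all compact $W$ with $|W|\ge w_0$ $$\frac{v_1}{\lambda|W|}\le\frac{\operatorname{var}(S)}{(\mathbb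 E U)^2}\le\frac{v_2}{\lambda|W|}.$$ -/

import Mathlib

open MeasureTheory ProbabilityTheory

/-- The Euclidean plane. -/
abbrev Plane : Type := EuclideanSpace ℝ (Fin 2)

/-- A planar set is locally finite if it has finitely many points in every compact set. -/
def IsLocallyFinite (s : Set Plane) : Prop :=
  ∀ K : Set Plane, IsCompact K → (s ∩ K).Finite

/-- The counting measure `B ↦ #(s ∩ B)` of a set of points `s`. -/
noncomputable def countingMeasure {X : Type*} [MeasurableSpace X] (s : Set X) : Measure X :=
  Measure.count.restrict s

section PointProcesses

variable {Ω : Type*}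

/-- The unmarked configuration of a marked configuration. -/
def unmarked (ψ : Set (Plane × ℝ)) : Set Plane := Prod.fst '' ψ

/-- The marked configuration obtained by sampling the field `z` at the points of `φ`. -/
def sampleMarks (z : Plane → ℝ) (φ : Set Plane) : Set (Plane × ℝ) := (fun x => (x, z x)) '' φ

/-- Translation of a marked configuration by `v`; the marks are kept. -/
def translateMarked (v : Plane) (ψ : Set (Plane × ℝ)) : Set (Plane × ℝ) :=
  (fun p => (p.1 + v, p.2)) '' ψ

/-- A stationary (simple) marked point process in the plane with real marks: a random set of marked
points whose counts in Borel sets are random variables (measurability of the counting measure for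
the σ-algebra on measures generated by the evaluations), whose points are locally finite and carry
one mark each, and whose law is invariant under translations of the points. -/
structure IsStationaryMarkedPointProcess [MeasurableSpace Ω] (P : Measure Ω)
    (Ψ : Ω → Set (Plane × ℝ)) : Prop where
  measurable : Measurable fun ω => countingMeasure (Ψ ω)
  locallyFinite : ∀ ω, IsLocallyFinite (unmarked (Ψ ω))
  injOn : ∀ ω, Set.InjOn Prod.fst (Ψ ω)
  stationary : ∀ v : Plane,
    P.map (fun ω => countingMeasure (translateMarked v (Ψ ω))) =
      P.map (fun ω => countingMeasure (Ψ ω))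

/-- `ρ` is a product density of order `k` of the point process `Φ`, i.e. a density of its `k`-th
factorial moment measure: the expected number of `k`-tuples of pairwise distinct points of `Φ`
lying in a Borel set `D` of `k`-tuples is `∫_D ρ`. -/
def IsProductDensity [MeasurableSpace Ω] (P : Measure Ω) (Φ : Ω → Set Plane) (k : ℕ)
    (ρ : (Fin k → Plane) → ℝ) : Prop :=
  Measurable ρ ∧ ∀ D : Set (Fin k → Plane), MeasurableSet D →
    ∫⁻ ω, Measure.count {x | x ∈ D ∧ Function.Injective x ∧ ∀ i, x i ∈ Φ ω} ∂P =
      ∫⁻ x in D, ENNReal.ofReal (ρ x)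

/-- `ρ` is bounded from above and from below by finite positive constants (almost everywhere,
as densities are only determined up to null sets). -/
def IsBoundedAboveBelow {k : ℕ} (ρ : (Fin k → Plane) → ℝ) : Prop :=
  ∃ m M : ℝ, 0 < m ∧ ∀ᵐ x, m ≤ ρ x ∧ ρ x ≤ M

/-- `Z` is a centred Gaussian random field with covariance function `C(u - v)`; such a field is
stationary, and its distribution is determined by `C`. -/
structure IsCentredStationaryGaussianField [MeasurableSpace Ω] (P : Measure Ω)
    (Z : Plane → Ω → ℝ) (C : Plane → ℝ) : Prop where
  gaussian : IsGaussianProcess Z P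
  centred : ∀ u, ∫ ω, Z u ω ∂P = 0
  covariance : ∀ u v, cov[Z u, Z v; P] = C (u - v)

/-- The point process `Φ` and the random fields `Z₁`, `Z₂` are mutually independent: they are
measurable with respect to independent σ-algebras. For the fields this is joint measurability in
`(ω, u)`, so that the independence covers field values at random locations; independence of
the finite-dimensional distributions alone would not control the values at the points of `Φ`. -/
def AreIndependent [MeasurableSpace Ω] (P : Measure Ω) (Φ : Ω → Set Plane)
    (Z₁ Z₂ : Plane → Ω → ℝ) : Prop :=
  ∃ 𝓐 : Fin 3 → MeasurableSpace Ω,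
    (∀ i, 𝓐 i ≤ ‹MeasurableSpace Ω›) ∧
    iIndep 𝓐 P ∧
    Measurable[𝓐 0] (fun ω => countingMeasure (Φ ω)) ∧
    Measurable[(𝓐 1).prod inferInstance] (fun p : Ω × Plane => Z₁ p.2 p.1) ∧
    Measurable[(𝓐 2).prod inferInstance] (fun p : Ω × Plane => Z₂ p.2 p.1)

/-- The geostatistical marking model: `Ψ` is obtained by sampling the mark field `Z₁` at the points
of the unmarked point process `Φ`. -/
def FollowsGeostatisticalMarking (Ψ : Ω → Set (Plane × ℝ)) (Φ : Ω → Set Plane)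
    (Z₁ : Plane → Ω → ℝ) : Prop :=
  ∀ ω, Φ ω = unmarked (Ψ ω) ∧ Ψ ω = sampleMarks (fun u => Z₁ u ω) (Φ ω)

/-- The unnormalised Kendall statistic
`S = ∑_{x ≠ y ∈ Φ ∩ W} sgn(Z₁(x) - Z₁(y)) sgn(Z₂(x) - Z₂(y))` (a sum over ordered pairs). -/
noncomputable def kendallSum (Φ : Ω → Set Plane) (Z₁ Z₂ : Plane → Ω → ℝ) (W : Set Plane)
    (ω : Ω) : ℝ :=
  ∑ᶠ p ∈ (Φ ω ∩ W).offDiag,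
    Real.sign (Z₁ p.1 ω - Z₁ p.2 ω) * Real.sign (Z₂ p.1 ω - Z₂ p.2 ω)

/-- The number `U = Φ(W) (Φ(W) - 1)` of ordered pairs of distinct points in `W`. -/
noncomputable def pairCount (Φ : Ω → Set Plane) (W : Set Plane) (ω : Ω) : ℝ :=
  ((Φ ω ∩ W).ncard : ℝ) * (((Φ ω ∩ W).ncard : ℝ) - 1)

/-- The first-order Taylor approximation of the ratio `S / U`: the first-order Taylor polynomial of
`(s, u) ↦ s / u` at `(𝔼 S, 𝔼 U)`, evaluated at `(S, U)`. -/
noncomputable def taylorRatio [MeasurableSpace Ω] (P : Measure Ω) (S U : Ω → ℝ) (ω : Ω) : ℝ :=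
  P[S] / P[U] +
    fderiv ℝ (fun q : ℝ × ℝ => q.1 / q.2) (P[S], P[U]) ((S ω, U ω) - (P[S], P[U]))

end PointProcesses

/-- The area `|W|`. -/
noncomputable def area (W : Set Plane) : ℝ := (volume W).toReal

/-! Expand `S ^ 2` by the coincidences between the two ordered pairs of points
(`sq_sum_eq_sum_distinct`, `kendallSum_sq_eq`). This gives a sum over quadruples of distinct points,
four times a sum over triples, and twice a sum over pairs.

Since `Φ`, `Z₁`, `Z₂` are independent, the mean of each sum is an integral of a product of two field
expectations against the factorial moment measure (`integral_sum_distinctTuples`). The fields have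
the same law, so the two expectations coincide (`signCov_eq`) and the integrand is the square of
`signCov`. The same formula gives `𝔼 S = 0`, because the sign of a centred Gaussian increment has
mean zero. Hence the variance of `S` is a sum of three non-negative integrals, and bounded product
densities reduce their estimation to Lebesgue measure on powers of `W`.

Quadruples: increments over pairs at mutual distance more than `R` are uncorrelated, hence
independent, so the integrand vanishes unless two points from different pairs are within `R`. The
integral is then at most a constant times `|W| ^ 3`. Triples: among three points with distinct
values, the sign products seen from the three vertices add up to one. The three expectations
therefore also add up to one, and the sum of their squares is at least 1/3. By symmetry the integral
is at least `|W| ^ 3 / 9`. Pairs: the field almost surely has no tie between two distinct points,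
since bounded support of `C` excludes a period (`covarianceFunction_ne`). The integrand is 1 almost
everywhere.

Quadruples and triples form `A`, pairs form `B`. The order of `𝔼 U` comes from the bounds on `lam₂`,
and because `𝔼 S = 0` the Taylor polynomial of the ratio is a multiple of `S`. -/

/-! ### Counting measures of tuples of points and their measurability. -/

theorem countingMeasure_apply {X : Type*} [MeasurableSpace X] (s : Set X) {B : Set X}
    (hB : MeasurableSet B) : countingMeasure s B = Measure.count (B ∩ s) :=
  Measure.restrict_apply hB

theorem countingMeasure_inter {X : Type*} [MeasurableSpace X] (s : Set X) {W : Set X}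
    (hW : MeasurableSet W) : countingMeasure (s ∩ W) = (countingMeasure s).restrict W := by
  rw [countingMeasure, countingMeasure, Measure.restrict_restrict hW, Set.inter_comm]

theorem isFiniteMeasure_countingMeasure {X : Type*} [MeasurableSpace X]
    [MeasurableSingletonClass X] {s : Set X} (hs : s.Finite) :
    IsFiniteMeasure (countingMeasure s) :=
  ⟨by rw [countingMeasure_apply _ MeasurableSet.univ, Set.univ_inter,
    Measure.count_apply_finite _ hs]; exact ENNReal.natCast_lt_top _⟩

/-- Power sets of a random finite set have measurable counting measures. -/
theorem measurable_countingMeasure_pi {Ω X : Type*} {_ : MeasurableSpace Ω} [MeasurableSpace X]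
    [MeasurableSingletonClass X] {s : Ω → Set X} (hfin : ∀ ω, (s ω).Finite)
    (hs : Measurable fun ω => countingMeasure (s ω)) (k : ℕ) :
    Measurable fun ω => countingMeasure {x : Fin k → X | ∀ i, x i ∈ s ω} := by
  have hpi : ∀ ω, {x : Fin k → X | ∀ i, x i ∈ s ω} = Set.pi Set.univ (fun _ => s ω) := by
    intro ω; ext x; simp
  have hfin' : ∀ ω, {x : Fin k → X | ∀ i, x i ∈ s ω}.Finite := fun ω => by
    rw [hpi]; exact Set.Finite.pi fun _ => hfin ω
  have : ∀ ω, IsFiniteMeasure (countingMeasure {x : Fin k → X | ∀ i, x i ∈ s ω}) :=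
    fun ω => isFiniteMeasure_countingMeasure (hfin' ω)
  -- Counts in boxes factor over the coordinates, and boxes are a π-system generating the product
  -- σ-algebra; as the measures are finite, measurability on boxes suffices.
  have key : ∀ B : Fin k → Set X, (∀ i, MeasurableSet (B i)) → ∀ ω,
      countingMeasure {x : Fin k → X | ∀ i, x i ∈ s ω} (Set.pi Set.univ B) =
        ∏ i, countingMeasure (s ω) (B i) := by
    intro B hB ω
    classical
    rw [countingMeasure_apply _ (MeasurableSet.univ_pi hB), hpi, ← Set.pi_inter_distrib]
    have hf : ∀ i, (B i ∩ s ω).Finite := fun i => (hfin ω).inter_of_right _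
    rw [Measure.count_apply_finite _ (Set.Finite.pi fun i => hf i)]
    have : (Set.Finite.pi fun i => hf i).toFinset = Fintype.piFinset fun i => (hf i).toFinset := by
      ext x; simp [Set.mem_pi]
    rw [this, Fintype.card_piFinset]
    push_cast
    refine Finset.prod_congr rfl fun i _ => ?_
    rw [countingMeasure_apply _ (hB i), Measure.count_apply_finite _ (hf i)]
  refine Measurable.measure_of_isPiSystem (generateFrom_pi (α := fun _ : Fin k => X)).symm isPiSystem_pi ?_ ?_
  · rintro _ ⟨B, hB, rfl⟩
    have hB' : ∀ i, MeasurableSet (B i) := fun i => hB i (Set.mem_univ i)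
    simp_rw [key B hB']
    exact Finset.measurable_prod _ fun i _ => (Measure.measurable_coe (hB' i)).comp hs
  · have := key (fun _ => Set.univ) (fun _ => MeasurableSet.univ)
    simp only [Set.pi_univ] at this
    simp_rw [this]
    exact Finset.measurable_prod _ fun i _ => (Measure.measurable_coe MeasurableSet.univ).comp hs

theorem measurableSet_injective (k : ℕ) :
    MeasurableSet {x : Fin k → Plane | Function.Injective x} := by
  have : {x : Fin k → Plane | Function.Injective x} =
      ⋂ i, ⋂ j, ({x | x i = x j}ᶜ ∪ {_x | i = j}) := by
    ext x; simp only [Function.Injective, Set.mem_ofPred_eq, Set.mem_iInter, Set.mem_union,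
      Set.mem_compl_iff]
    exact forall₂_congr fun i j => imp_iff_not_or
  rw [this]
  exact MeasurableSet.iInter fun i => MeasurableSet.iInter fun j =>
    (measurableSet_eq_fun (measurable_pi_apply i) (measurable_pi_apply j)).compl.union
      (MeasurableSet.const _)

/-- The `k`-tuples of pairwise distinct points of `φ` in `W`. -/
def distinctTuples (k : ℕ) (φ W : Set Plane) : Set (Fin k → Plane) :=
  {x | Function.Injective x ∧ ∀ i, x i ∈ φ ∩ W}

theorem distinctTuples_finite {k : ℕ} {φ W : Set Plane} (h : (φ ∩ W).Finite) :
    (distinctTuples k φ W).Finite :=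
  (Set.Finite.pi (t := fun _ : Fin k => φ ∩ W) fun _ => h).subset fun _ hx i _ => hx.2 i

theorem measurable_restrict_measure {X : Type*} [MeasurableSpace X] {W : Set X}
    (hW : MeasurableSet W) : Measurable fun μ : Measure X => μ.restrict W := by
  refine Measure.measurable_of_measurable_coe _ fun B hB => ?_
  simp_rw [Measure.restrict_apply hB]
  exact Measure.measurable_coe (hB.inter hW)

/-- The σ-algebra on `Ω` is left free so that it can be the one generated by the point process side
of the independence assumption. -/
theorem measurable_countingMeasure_distinctTuples {Ω : Type*} {_ : MeasurableSpace Ω}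
    {Φ : Ω → Set Plane} {W : Set Plane} (hW : MeasurableSet W)
    (hfin : ∀ ω, (Φ ω ∩ W).Finite)
    (hs : Measurable fun ω => countingMeasure (Φ ω)) (k : ℕ) :
    Measurable fun ω => countingMeasure (distinctTuples k (Φ ω) W) := by
  have h1 : Measurable fun ω => countingMeasure (Φ ω ∩ W) := by
    simp_rw [countingMeasure_inter _ hW]
    exact (measurable_restrict_measure hW).comp hs
  have h2 := measurable_countingMeasure_pi hfin h1 k
  have h3 : ∀ ω, countingMeasure (distinctTuples k (Φ ω) W) =
      (countingMeasure {x : Fin k → Plane | ∀ i, x i ∈ Φ ω ∩ W}).restrict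
        {x | Function.Injective x} := fun ω => by
    rw [← countingMeasure_inter _ (measurableSet_injective k)]
    congr 1
    ext x
    exact and_comm
  simp_rw [h3]
  exact (measurable_restrict_measure (measurableSet_injective k)).comp h2

/-! ### Integration against an independent random measure. -/

/-- A kernel of finite measures is s-finite. -/
theorem isSFiniteKernel_of_isFiniteMeasure {α β : Type*} {_ : MeasurableSpace α}
    {_ : MeasurableSpace β} (κ : Kernel α β) (h : ∀ a, IsFiniteMeasure (κ a)) :
    IsSFiniteKernel κ := by
  classical
  have hm : Measurable fun a => κ a Set.univ := κ.measurable_coe MeasurableSet.univ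
  -- Slices by the integer part of the total mass: on each slice the kernel is uniformly bounded,
  -- and each point lies in exactly one slice.
  let s : ℕ → Set α := fun n => {a | (n : ENNReal) ≤ κ a Set.univ ∧ κ a Set.univ < n + 1}
  have hs : ∀ n, MeasurableSet (s n) := fun n =>
    (measurableSet_le measurable_const hm).inter (measurableSet_lt hm measurable_const)
  refine ⟨fun n => Kernel.piecewise (hs n) κ 0, fun n => ⟨n + 1, by finiteness, fun a => ?_⟩, ?_⟩
  · rw [Kernel.piecewise_apply]
    split_ifs with ha
    · exact ha.2.le
    · simp
  · ext a B hB
    rw [Kernel.sum_apply' _ _ hB]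
    have hfin : κ a Set.univ ≠ ⊤ := measure_ne_top _ _
    let n₀ := ⌊(κ a Set.univ).toReal⌋₊
    have hmem : ∀ n, a ∈ s n ↔ n = n₀ := by
      intro n
      have e : κ a Set.univ = ENNReal.ofReal (κ a Set.univ).toReal := (ENNReal.ofReal_toReal hfin).symm
      have h1 : (n : ENNReal) = ENNReal.ofReal n := by simp
      have h2 : (n : ENNReal) + 1 = ENNReal.ofReal (n + 1) := by
        rw [ENNReal.ofReal_add (by positivity) zero_le_one]; simp
      simp only [s, Set.mem_ofPred_eq]
      rw [eq_comm, Nat.floor_eq_iff ENNReal.toReal_nonneg, h2, h1, e,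
        ENNReal.ofReal_le_ofReal_iff ENNReal.toReal_nonneg,
        ENNReal.ofReal_lt_ofReal_iff (by positivity), ENNReal.toReal_ofReal ENNReal.toReal_nonneg]
    rw [tsum_eq_single n₀]
    · rw [Kernel.piecewise_apply, if_pos ((hmem _).2 rfl)]
    · intro n hn
      rw [Kernel.piecewise_apply, if_neg (fun h => hn ((hmem _).1 h))]
      simp

/-- Integration of a random function against an independent random measure `κ` with mean measure
`μ`. -/
theorem integral_compProd_of_indep {Ω E : Type*} {m₀ m₁ mΩ : MeasurableSpace Ω}
    [MeasurableSpace E] {P : Measure Ω} [IsProbabilityMeasure P] (h₀ : m₀ ≤ mΩ)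
    (h₁ : m₁ ≤ mΩ) (hind : Indep m₀ m₁ P) (κ : Ω → Measure E) (hκ : Measurable[m₀] κ)
    (hfin : ∀ ω, IsFiniteMeasure (κ ω)) (μ : Measure E) [IsFiniteMeasure μ]
    (hμ : ∀ D, MeasurableSet D → ∫⁻ ω, κ ω D ∂P = μ D) (f : Ω × E → ℝ)
    (hf : Measurable[m₁.prod inferInstance] f) (M : ℝ) (hM : ∀ p, |f p| ≤ M) :
    Integrable (fun ω => ∫ x, f (ω, x) ∂(κ ω)) P ∧
      ∫ ω, ∫ x, f (ω, x) ∂(κ ω) ∂P = ∫ x, ∫ ω, f (ω, x) ∂P ∂μ := by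
  let K : Kernel Ω E := ⟨κ, hκ.mono h₀ le_rfl⟩
  have : IsSFiniteKernel K := isSFiniteKernel_of_isFiniteMeasure K hfin
  have hle : m₁.prod (inferInstance : MeasurableSpace E) ≤ mΩ.prod inferInstance :=
    sup_le_sup (MeasurableSpace.comap_mono h₁) le_rfl
  -- Independence enters here only: the indicator of `A` is independent of the mass `κ ω D`.
  have hrect : ∀ A D, MeasurableSet[m₁] A → MeasurableSet D →
      (P ⊗ₘ K) (A ×ˢ D) = (P.prod μ) (A ×ˢ D) := by
    intro A D hA hD
    rw [Measure.compProd_apply_prod (h₁ _ hA) hD, Measure.prod_prod, ← hμ D hD, mul_comm,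
      ← lintegral_indicator (h₁ _ hA)]
    have := lintegral_mul_eq_lintegral_mul_lintegral_of_independent_measurableSpace
      (μ := P) h₀ h₁ hind (f := fun ω => κ ω D) (g := A.indicator 1)
      ((Measure.measurable_coe hD).comp hκ) (@Measurable.indicator _ _ _ _ m₁ _ _ (@measurable_one _ _ _ m₁ _) hA)
    rw [lintegral_indicator_one (h₁ _ hA)] at this
    rw [← this]
    refine lintegral_congr fun ω => ?_
    by_cases h : ω ∈ A <;> simp [h, K]
  have huniv : (P ⊗ₘ K) Set.univ = (P.prod μ) Set.univ := by
    rw [← Set.univ_prod_univ]; exact hrect _ _ MeasurableSet.univ MeasurableSet.univ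
  have hF : IsFiniteMeasure (P ⊗ₘ K) := ⟨by rw [huniv]; exact measure_lt_top _ _⟩
  -- The two measures need not agree on the full product σ-algebra, since `κ` itself depends on `ω`.
  -- They agree on the smaller one for which `f` is measurable.
  have htrim : (P ⊗ₘ K).trim hle = (P.prod μ).trim hle := by
    have := isFiniteMeasure_trim (μ := P ⊗ₘ K) hle
    refine ext_of_generate_finite (m0 := m₁.prod inferInstance) _
      (@generateFrom_prod Ω E m₁ _).symm (@isPiSystem_prod Ω E m₁ _) ?_ ?_
    · rintro _ ⟨A, hA, D, hD, rfl⟩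
      have hAD : MeasurableSet[m₁.prod inferInstance] (A ×ˢ D) := @MeasurableSet.prod Ω E m₁ _ _ _ hA hD
      rw [trim_measurableSet_eq hle hAD, trim_measurableSet_eq hle hAD, hrect A D hA hD]
    · rw [trim_measurableSet_eq hle MeasurableSet.univ, trim_measurableSet_eq hle MeasurableSet.univ, huniv]
  have hint : ∀ ν : Measure (Ω × E), IsFiniteMeasure ν → Integrable f ν := fun ν _ =>
    Integrable.of_bound (hf.mono hle le_rfl).aestronglyMeasurable M
      (Filter.Eventually.of_forall fun p => hM p)
  have hsm : StronglyMeasurable[m₁.prod inferInstance] f :=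
    hf.stronglyMeasurable
  have hI := (hint (P ⊗ₘ K) hF).integral_compProd
  simp only [Kernel.prodMkLeft_apply, Kernel.const_apply] at hI
  refine ⟨hI, ?_⟩
  calc ∫ ω, ∫ x, f (ω, x) ∂(κ ω) ∂P = ∫ p, f p ∂(P ⊗ₘ K) :=
        (Measure.integral_compProd (hint (P ⊗ₘ K) hF)).symm
    _ = ∫ p, f p ∂(P.prod μ) := by
        rw [integral_trim hle hsm, htrim, ← integral_trim hle hsm]
    _ = _ := integral_prod_symm _ (hint _ inferInstance)

/-! ### Sums over tuples and the square of a double sum. -/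

theorem sum_piFinset_succ {X : Type*} (F : Finset X) (n : ℕ) (f : (Fin (n + 1) → X) → ℝ) :
    ∑ x ∈ Fintype.piFinset (fun _ : Fin (n + 1) => F), f x =
      ∑ a ∈ F, ∑ x ∈ Fintype.piFinset (fun _ : Fin n => F), f (Fin.cons a x) := by
  rw [← Finset.sum_product']
  refine Finset.sum_bij' (fun x _ => (x 0, Fin.tail x)) (fun p _ => Fin.cons p.1 p.2) ?_ ?_ ?_ ?_ ?_
  · intro x hx
    simp only [Fintype.mem_piFinset, Finset.mem_product] at hx ⊢
    exact ⟨hx 0, fun i => hx _⟩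
  · intro p hp
    simp only [Fintype.mem_piFinset, Finset.mem_product] at hp ⊢
    exact Fin.cases hp.1 hp.2
  · intro x _; exact Fin.cons_self_tail x
  · intro p _; simp
  · intro x _; simp

open Classical in
/-- Integration with respect to the counting measure of the tuples of distinct points. -/
theorem integral_countingMeasure_distinctTuples {k : ℕ} {φ W : Set Plane}
    (h : (φ ∩ W).Finite) (f : (Fin k → Plane) → ℝ) :
    ∫ x, f x ∂(countingMeasure (distinctTuples k φ W)) =
      ∑ x ∈ Fintype.piFinset (fun _ : Fin k => h.toFinset),
        if Function.Injective x then f x else 0 := by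
  have hfin := distinctTuples_finite (k := k) h
  have hF := isFiniteMeasure_countingMeasure hfin
  have hI : IntegrableOn f hfin.toFinset Measure.count := by
    have := IntegrableOn.of_finite (μ := countingMeasure (distinctTuples k φ W)) (f := f) hfin
    rwa [hfin.coe_toFinset, IntegrableOn, ← Measure.restrict_restrict_of_subset subset_rfl]
  rw [countingMeasure, ← (distinctTuples_finite h).coe_toFinset, setIntegral_finset _ hI,
    ← Finset.sum_filter]
  simp only [Measure.real, Measure.count_singleton, ENNReal.toReal_one, one_smul]
  refine Finset.sum_congr ?_ fun _ _ => rfl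
  ext x
  simp only [Set.Finite.mem_toFinset, Finset.mem_filter, Fintype.mem_piFinset]
  exact and_comm

theorem injective_fin_two_iff {X : Type*} {x : Fin 2 → X} :
    Function.Injective x ↔ x 0 ≠ x 1 := by
  rw [Function.Injective]
  simp only [Fin.forall_fin_succ, Fin.isValue]
  simp [eq_comm]

theorem injective_fin_three_iff {X : Type*} {x : Fin 3 → X} :
    Function.Injective x ↔ x 0 ≠ x 1 ∧ x 0 ≠ x 2 ∧ x 1 ≠ x 2 := by
  refine ⟨fun h => ⟨h.ne (by decide), h.ne (by decide), h.ne (by decide)⟩, ?_⟩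
  rintro ⟨h1, h2, h3⟩ i j hij
  fin_cases i <;> fin_cases j <;> simp_all

theorem injective_fin_four_iff {X : Type*} {x : Fin 4 → X} :
    Function.Injective x ↔ x 0 ≠ x 1 ∧ x 0 ≠ x 2 ∧ x 0 ≠ x 3 ∧ x 1 ≠ x 2 ∧ x 1 ≠ x 3 ∧ x 2 ≠ x 3 := by
  refine ⟨fun h => ⟨h.ne (by decide), h.ne (by decide), h.ne (by decide), h.ne (by decide),
    h.ne (by decide), h.ne (by decide)⟩, ?_⟩
  rintro ⟨h1, h2, h3, h4, h5, h6⟩ i j hij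
  fin_cases i <;> fin_cases j <;> simp_all

/-- The square of a double sum split according to the coincidences between the indices. -/
theorem sq_sum_eq_sum_distinct {X : Type*} [DecidableEq X] (F : Finset X) (g : X → X → ℝ)
    (hsymm : ∀ x y, g x y = g y x) (hdiag : ∀ x, g x x = 0) :
    (∑ x ∈ F, ∑ y ∈ F, g x y) ^ 2 =
      (∑ x ∈ F, ∑ y ∈ F, ∑ u ∈ F, ∑ v ∈ F,
        if x ≠ u ∧ x ≠ v ∧ y ≠ u ∧ y ≠ v then g x y * g u v else 0) +
      4 * (∑ x ∈ F, ∑ y ∈ F, ∑ v ∈ F, if y ≠ v then g x y * g x v else 0) +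
      2 * ∑ x ∈ F, ∑ y ∈ F, g x y ^ 2 := by
  -- Inclusion–exclusion over the four coincidences. Only the double coincidences matching the pairs
  -- survive; the others force `x = y` or `u = v`, where `g` vanishes.
  have h4 : ∀ x y u v, (if x ≠ u ∧ x ≠ v ∧ y ≠ u ∧ y ≠ v then g x y * g u v else 0) =
      g x y * g u v - (if x = u then g x y * g x v else 0) - (if x = v then g x y * g u x else 0)
      - (if y = u then g x y * g y v else 0) - (if y = v then g x y * g u y else 0)
      + (if x = u then if y = v then g x y * g x y else 0 else 0)
      + (if x = v then if y = u then g x y * g y x else 0 else 0) := by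
    intro x y u v
    by_cases h1 : x = u <;> by_cases h2 : x = v <;> by_cases h3 : y = u <;> by_cases h4 : y = v <;>
      simp_all
  have h3 : ∀ x y v, (if y ≠ v then g x y * g x v else 0) =
      g x y * g x v - (if y = v then g x y * g x y else 0) := by
    intro x y v
    by_cases h : y = v <;> simp_all
  have hd : ∀ x ∈ F, ∀ f : X → ℝ, ∑ u ∈ F, (if x = u then f u else 0) = f x := by
    intro x hx f; simp [hx]
  have e4 : ∀ x ∈ F, ∀ y ∈ F, (∑ u ∈ F, ∑ v ∈ F,
        if x ≠ u ∧ x ≠ v ∧ y ≠ u ∧ y ≠ v then g x y * g u v else 0) =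
      g x y * (∑ u ∈ F, ∑ v ∈ F, g u v) - 2 * (g x y * ∑ v ∈ F, g x v)
        - 2 * (g x y * ∑ v ∈ F, g y v) + 2 * g x y ^ 2 := by
    intro x hx y hy
    simp_rw [h4, Finset.sum_add_distrib, Finset.sum_sub_distrib]
    have a1 : ∑ u ∈ F, ∑ v ∈ F, (if x = u then g x y * g x v else 0) = g x y * ∑ v ∈ F, g x v := by
      rw [Finset.sum_comm, Finset.mul_sum]
      exact Finset.sum_congr rfl fun v _ => hd x hx fun _ => g x y * g x v
    have a2 : ∑ u ∈ F, ∑ v ∈ F, (if x = v then g x y * g u x else 0) = g x y * ∑ v ∈ F, g x v := by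
      rw [Finset.mul_sum]
      refine Finset.sum_congr rfl fun v _ => ?_
      rw [hd x hx fun _ => g x y * g v x, hsymm v x]
    have a3 : ∑ u ∈ F, ∑ v ∈ F, (if y = u then g x y * g y v else 0) = g x y * ∑ v ∈ F, g y v := by
      rw [Finset.sum_comm, Finset.mul_sum]
      exact Finset.sum_congr rfl fun v _ => hd y hy fun _ => g x y * g y v
    have a4 : ∑ u ∈ F, ∑ v ∈ F, (if y = v then g x y * g u y else 0) = g x y * ∑ v ∈ F, g y v := by
      rw [Finset.mul_sum]
      refine Finset.sum_congr rfl fun v _ => ?_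
      rw [hd y hy fun _ => g x y * g v y, hsymm v y]
    have a5 : ∑ u ∈ F, ∑ v ∈ F, (if x = u then if y = v then g x y * g x y else 0 else 0) =
        g x y ^ 2 := by
      rw [Finset.sum_comm]
      rw [Finset.sum_congr rfl fun v _ => hd x hx fun _ => if y = v then g x y * g x y else 0,
        hd y hy fun _ => g x y * g x y, sq]
    have a6 : ∑ u ∈ F, ∑ v ∈ F, (if x = v then if y = u then g x y * g y x else 0 else 0) =
        g x y ^ 2 := by
      rw [Finset.sum_congr rfl fun u _ => hd x hx fun _ => if y = u then g x y * g y x else 0,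
        hd y hy fun _ => g x y * g y x, sq, hsymm y x]
    rw [a1, a2, a3, a4, a5, a6]
    simp_rw [← Finset.mul_sum]
    ring
  have e3 : ∀ x ∈ F, ∀ y ∈ F, (∑ v ∈ F, if y ≠ v then g x y * g x v else 0) =
      g x y * (∑ v ∈ F, g x v) - g x y ^ 2 := by
    intro x hx y hy
    simp_rw [h3, Finset.sum_sub_distrib]
    rw [hd y hy fun _ => g x y * g x y, Finset.mul_sum, sq]
  rw [Finset.sum_congr rfl fun x hx => Finset.sum_congr rfl fun y hy => e4 x hx y hy,
    Finset.sum_congr rfl fun x hx => Finset.sum_congr rfl fun y hy => e3 x hx y hy]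
  have c : ∑ x ∈ F, ∑ y ∈ F, g x y * ∑ v ∈ F, g y v = ∑ x ∈ F, ∑ y ∈ F, g x y * ∑ v ∈ F, g x v := by
    rw [Finset.sum_comm]
    exact Finset.sum_congr rfl fun x _ => Finset.sum_congr rfl fun y _ => by rw [hsymm]
  simp only [Finset.sum_add_distrib, Finset.sum_sub_distrib, ← Finset.mul_sum, ← Finset.sum_mul]
  simp only [← Finset.sum_mul] at c
  rw [c]
  ring

/-! ### Signs of differences. -/

/-- `sgn(f(x) - f(y))`. -/
noncomputable def signDiff {X : Type*} (f : X → ℝ) (x y : X) : ℝ := Real.sign (f x - f y)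

theorem signDiff_self {X : Type*} (f : X → ℝ) (x : X) : signDiff f x x = 0 := by
  simp [signDiff]

theorem signDiff_comm {X : Type*} (f : X → ℝ) (x y : X) : signDiff f x y = -signDiff f y x := by
  rw [signDiff, signDiff, ← neg_sub, Real.sign_neg]

theorem abs_sign_le_one (a : ℝ) : |Real.sign a| ≤ 1 := by
  rcases Real.sign_apply_eq a with h | h | h <;> rw [h] <;> norm_num

theorem abs_signDiff_le_one {X : Type*} (f : X → ℝ) (x y : X) : |signDiff f x y| ≤ 1 :=
  abs_sign_le_one _

theorem measurable_sign : Measurable Real.sign := by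
  unfold Real.sign
  exact Measurable.ite measurableSet_Iio measurable_const
    (Measurable.ite measurableSet_Ioi measurable_const measurable_const)

/-- Summed over the vertices of a triangle with distinct values, the products of the signs of the
two differences give one. -/
theorem sum_signDiff_eq_one {X : Type*} (f : X → ℝ) {x y v : X} (hxy : f x ≠ f y) :
    signDiff f x y * signDiff f x v + signDiff f y x * signDiff f y v +
      signDiff f v x * signDiff f v y = 1 := by
  simp only [signDiff]
  rcases lt_trichotomy (f x) (f y) with h | h | h
  · rw [Real.sign_of_neg (sub_neg.2 h), Real.sign_of_pos (sub_pos.2 h)]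
    rcases lt_trichotomy (f x) (f v) with h' | h' | h' <;>
    rcases lt_trichotomy (f y) (f v) with h'' | h'' | h'' <;>
    first
    | (exfalso; linarith)
    | simp [h', h'', Real.sign_of_neg, Real.sign_of_pos]
  · exact absurd h hxy
  · rw [Real.sign_of_pos (sub_pos.2 h), Real.sign_of_neg (sub_neg.2 h)]
    rcases lt_trichotomy (f x) (f v) with h' | h' | h' <;>
    rcases lt_trichotomy (f y) (f v) with h'' | h'' | h'' <;>
    first
    | (exfalso; linarith)
    | simp [h', h'', Real.sign_of_neg, Real.sign_of_pos]

theorem cons_two_of_three {X : Type*} (x y v : X) (z : Fin 0 → X) :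
    (Fin.cons x (Fin.cons y (Fin.cons v z)) : Fin 3 → X) 2 = v := rfl

theorem cons_two_of_four {X : Type*} (x y u v : X) (z : Fin 0 → X) :
    (Fin.cons x (Fin.cons y (Fin.cons u (Fin.cons v z))) : Fin 4 → X) 2 = u := rfl

theorem cons_three_of_four {X : Type*} (x y u v : X) (z : Fin 0 → X) :
    (Fin.cons x (Fin.cons y (Fin.cons u (Fin.cons v z))) : Fin 4 → X) 3 = v := rfl

/-! ### The Kendall statistic and the pair count as integrals over tuples. -/

section PointSums

variable {Ω : Type*} (Φ : Ω → Set Plane) (Z₁ Z₂ : Plane → Ω → ℝ) (W : Set Plane) (ω : Ω)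

/-- The contribution of a pair of points to the Kendall statistic. -/
noncomputable def concordance (x y : Plane) : ℝ :=
  signDiff (fun u => Z₁ u ω) x y * signDiff (fun u => Z₂ u ω) x y

theorem concordance_comm (x y : Plane) : concordance Z₁ Z₂ ω x y = concordance Z₁ Z₂ ω y x := by
  rw [concordance, concordance, signDiff_comm _ x y, signDiff_comm _ x y, neg_mul_neg]

theorem concordance_self (x : Plane) : concordance Z₁ Z₂ ω x x = 0 := by
  rw [concordance, signDiff_self, zero_mul]

variable {Φ W ω}

/-- Finiteness keeps `finsum` from its default value 0, and the diagonal can be added since it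
contributes nothing. -/
theorem kendallSum_eq_sum (h : (Φ ω ∩ W).Finite) :
    kendallSum Φ Z₁ Z₂ W ω =
      ∑ x ∈ h.toFinset, ∑ y ∈ h.toFinset, concordance Z₁ Z₂ ω x y := by
  classical
  have e : (Φ ω ∩ W).offDiag = ↑(h.toFinset.offDiag) := by
    rw [Finset.coe_offDiag, h.coe_toFinset]
  rw [kendallSum, e, finsum_mem_coe_finset, ← Finset.sum_product',
    ← Finset.diag_union_offDiag, Finset.sum_union (Finset.disjoint_diag_offDiag _)]
  rw [Finset.sum_eq_zero (s := Finset.diag _), zero_add]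
  · rfl
  · intro p hp
    rw [Finset.mem_diag] at hp
    rw [← hp.2, concordance_self]

theorem kendallSum_eq_integral (h : (Φ ω ∩ W).Finite) :
    kendallSum Φ Z₁ Z₂ W ω =
      ∫ x, concordance Z₁ Z₂ ω (x 0) (x 1) ∂(countingMeasure (distinctTuples 2 (Φ ω) W)) := by
  rw [kendallSum_eq_sum Z₁ Z₂ h, integral_countingMeasure_distinctTuples h]
  simp only [injective_fin_two_iff, sum_piFinset_succ]
  refine Finset.sum_congr rfl fun x _ => Finset.sum_congr rfl fun y _ => ?_
  by_cases hxy : x = y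
  · simp [hxy, concordance_self]
  · simp [hxy]

theorem pairCount_eq_integral (h : (Φ ω ∩ W).Finite) :
    pairCount Φ W ω = ∫ _, (1 : ℝ) ∂(countingMeasure (distinctTuples 2 (Φ ω) W)) := by
  classical
  rw [integral_countingMeasure_distinctTuples h]
  simp only [injective_fin_two_iff, sum_piFinset_succ]
  have : ∀ x ∈ h.toFinset, ∑ y ∈ h.toFinset, (if x ≠ y then (1 : ℝ) else 0) =
      (Φ ω ∩ W).ncard - 1 := by
    intro x hx
    rw [Set.ncard_eq_toFinset_card _ h]
    have e : ∀ y, (if x ≠ y then (1 : ℝ) else 0) = 1 - if x = y then 1 else 0 := by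
      intro y; by_cases hxy : x = y <;> simp [hxy]
    simp_rw [e, Finset.sum_sub_distrib]
    simp [hx]
  rw [pairCount]
  simp only [Fin.cons_zero, Fin.cons_one, Fintype.piFinset_of_isEmpty, Finset.univ_unique,
    Finset.sum_singleton]
  rw [Finset.sum_congr rfl this, Finset.sum_const, Set.ncard_eq_toFinset_card _ h, nsmul_eq_mul]

/-- The algebraic expansion requires only points of different pairs to be distinct; full injectivity
of the tuples comes for free because `concordance` vanishes on the diagonal. -/
theorem kendallSum_sq_eq (h : (Φ ω ∩ W).Finite) :
    kendallSum Φ Z₁ Z₂ W ω ^ 2 =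
      ∫ x, concordance Z₁ Z₂ ω (x 0) (x 1) * concordance Z₁ Z₂ ω (x 2) (x 3)
          ∂(countingMeasure (distinctTuples 4 (Φ ω) W)) +
        4 * ∫ x, concordance Z₁ Z₂ ω (x 0) (x 1) * concordance Z₁ Z₂ ω (x 0) (x 2)
          ∂(countingMeasure (distinctTuples 3 (Φ ω) W)) +
        2 * ∫ x, concordance Z₁ Z₂ ω (x 0) (x 1) ^ 2
          ∂(countingMeasure (distinctTuples 2 (Φ ω) W)) := by
  classical
  have hd := concordance_self Z₁ Z₂ ω
  rw [kendallSum_eq_sum Z₁ Z₂ h, sq_sum_eq_sum_distinct _ _ (concordance_comm Z₁ Z₂ ω) hd]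
  simp only [integral_countingMeasure_distinctTuples h, injective_fin_two_iff,
    injective_fin_three_iff, injective_fin_four_iff, sum_piFinset_succ,
    cons_two_of_three, cons_two_of_four, cons_three_of_four]
  congr 1
  · congr 1
    · refine Finset.sum_congr rfl fun x _ => Finset.sum_congr rfl fun y _ =>
        Finset.sum_congr rfl fun u _ => Finset.sum_congr rfl fun v _ => ?_
      by_cases hxy : x = y
      · simp [hxy, hd]
      by_cases huv : u = v
      · simp [huv, hd]
      simp [hxy, huv]
    · congr 1
      refine Finset.sum_congr rfl fun x _ => Finset.sum_congr rfl fun y _ =>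
        Finset.sum_congr rfl fun v _ => ?_
      by_cases hxy : x = y
      · simp [hxy, hd]
      by_cases hxv : x = v
      · simp [hxv, hd]
      simp [hxy, hxv]
  · congr 1
    refine Finset.sum_congr rfl fun x _ => Finset.sum_congr rfl fun y _ => ?_
    by_cases hxy : x = y
    · simp [hxy, hd]
    · simp [hxy]

end PointSums

/-! ### Increments of a centred stationary Gaussian field. -/

/-- The law of a centred Gaussian pair is determined by its covariances. -/
theorem map_prodMk_eq_of_covariance_eq {Ω : Type*} [MeasurableSpace Ω] {P : Measure Ω}
    [IsProbabilityMeasure P] {X Y X' Y' : Ω → ℝ}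
    (h : HasGaussianLaw (fun ω => (X ω, Y ω)) P) (h' : HasGaussianLaw (fun ω => (X' ω, Y' ω)) P)
    (hX : P[X] = 0) (hY : P[Y] = 0) (hX' : P[X'] = 0) (hY' : P[Y'] = 0)
    (hXX : cov[X, X; P] = cov[X', X'; P]) (hXY : cov[X, Y; P] = cov[X', Y'; P])
    (hYY : cov[Y, Y; P] = cov[Y', Y'; P]) :
    P.map (fun ω => (X ω, Y ω)) = P.map (fun ω => (X' ω, Y' ω)) := by
  have key : ∀ {X Y : Ω → ℝ}, HasGaussianLaw (fun ω => (X ω, Y ω)) P → P[X] = 0 → P[Y] = 0 →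
      ∀ L : StrongDual ℝ (ℝ × ℝ), ∫ ω, L (X ω, Y ω) ∂P = 0 ∧
        Var[fun ω => L (X ω, Y ω); P] = cov[X, X; P] * L (1, 0) ^ 2 +
          2 * (cov[X, Y; P] * L (1, 0) * L (0, 1)) + cov[Y, Y; P] * L (0, 1) ^ 2 := by
    intro X Y h hX hY L
    have hL : ∀ ω, L (X ω, Y ω) = X ω * L (1, 0) + Y ω * L (0, 1) := by
      intro ω
      have : (X ω, Y ω) = X ω • ((1, 0) : ℝ × ℝ) + Y ω • ((0, 1) : ℝ × ℝ) := by simp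
      rw [this, map_add, map_smul, map_smul, smul_eq_mul, smul_eq_mul]
    have mX := h.fst.memLp_two
    have mY := h.snd.memLp_two
    have aX := h.fst.aemeasurable
    have aY := h.snd.aemeasurable
    simp_rw [hL]
    constructor
    · rw [integral_add (h.fst.integrable.mul_const _) (h.snd.integrable.mul_const _),
        integral_mul_const, integral_mul_const, hX, hY]
      simp
    · rw [variance_fun_add (mX.mul_const _) (mY.mul_const _), variance_mul_const,
        variance_mul_const, covariance_mul_const_left, covariance_mul_const_right,
        covariance_self aX, covariance_self aY]
      ring
  have := h.isGaussian_map
  have := h'.isGaussian_map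
  refine Measure.ext_of_charFunDual ?_
  ext L
  rw [h.charFunDual_map_eq_fun, h'.charFunDual_map_eq_fun, (key h hX hY L).1, (key h hX hY L).2,
    (key h' hX' hY' L).1, (key h' hX' hY' L).2, hXX, hXY, hYY]

namespace IsCentredStationaryGaussianField

variable {Ω : Type*} [MeasurableSpace Ω] {P : Measure Ω} {Z : Plane → Ω → ℝ} {C : Plane → ℝ}

theorem memLp_two (hZ : IsCentredStationaryGaussianField P Z C) (x : Plane) : MemLp (Z x) 2 P :=
  (hZ.gaussian.hasGaussianLaw_eval x).memLp_two

theorem hasGaussianLaw_increments (hZ : IsCentredStationaryGaussianField P Z C)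
    (x y u v : Plane) : HasGaussianLaw (fun ω => (Z x ω - Z y ω, Z u ω - Z v ω)) P := by
  classical
  let D : Plane × Plane → Ω → ℝ := fun p ω => Z p.1 ω - Z p.2 ω
  have hD : IsGaussianProcess D P := hZ.gaussian.of_isGaussianProcess fun p =>
    ⟨{p.1, p.2},
      { toFun := fun z => z ⟨p.1, by simp⟩ - z ⟨p.2, by simp⟩
        map_add' := fun a b => by simp; ring
        map_smul' := fun c a => by simp; ring
        cont := by fun_prop }, fun ω => by simp [D]⟩
  exact hD.hasGaussianLaw_prodMk (s := (x, y)) (t := (u, v))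

theorem covarianceFunction_neg (hZ : IsCentredStationaryGaussianField P Z C) (h : Plane) :
    C (-h) = C h := by
  have h1 := hZ.covariance 0 h
  have h2 := hZ.covariance h 0
  rw [covariance_comm, h2] at h1
  simpa using h1.symm

theorem aestronglyMeasurable_signDiff (hZ : IsCentredStationaryGaussianField P Z C)
    (x y : Plane) : AEStronglyMeasurable (fun ω => signDiff (fun w => Z w ω) x y) P :=
  (measurable_sign.comp_aemeasurable
    (hZ.hasGaussianLaw_increments x y x y).fst.aemeasurable).aestronglyMeasurable

variable [IsProbabilityMeasure P]

theorem integral_increment (hZ : IsCentredStationaryGaussianField P Z C) (x y : Plane) :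
    ∫ ω, (Z x ω - Z y ω) ∂P = 0 := by
  rw [integral_sub ((hZ.memLp_two x).integrable one_le_two)
    ((hZ.memLp_two y).integrable one_le_two), hZ.centred, hZ.centred, sub_zero]

theorem covariance_increments (hZ : IsCentredStationaryGaussianField P Z C) (x y u v : Plane) :
    cov[fun ω => Z x ω - Z y ω, fun ω => Z u ω - Z v ω; P] =
      C (x - u) - C (x - v) - (C (y - u) - C (y - v)) := by
  rw [covariance_fun_sub_fun_sub (hZ.memLp_two x) (hZ.memLp_two y) (hZ.memLp_two u)
    (hZ.memLp_two v)]
  simp only [hZ.covariance]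
  ring

theorem variance_increment (hZ : IsCentredStationaryGaussianField P Z C) (x y : Plane) :
    Var[fun ω => Z x ω - Z y ω; P] = 2 * (C 0 - C (x - y)) := by
  rw [← covariance_self (hZ.hasGaussianLaw_increments x y x y).fst.aemeasurable,
    hZ.covariance_increments, ← neg_sub x y, hZ.covarianceFunction_neg]
  simp only [sub_self]
  ring

/-- A field whose covariance function has bounded support is nowhere periodic. -/
theorem covarianceFunction_ne (hZ : IsCentredStationaryGaussianField P Z C) {R : ℝ}
    (hR : ∀ h, R < ‖h‖ → C h = 0) (h0 : C 0 ≠ 0) {h : Plane} (hh : h ≠ 0) : C h ≠ C 0 := by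
  intro hC
  -- If `C h = C 0`, the increment over `h` has variance zero. Iterating gives `Z (n • h) = Z 0`
  -- almost surely, but for large `n` these two values are uncorrelated with non-zero variance.
  have step : ∀ u, Z (u + h) =ᵐ[P] Z u := by
    intro u
    have hv : Var[fun ω => Z (u + h) ω - Z u ω; P] = 0 := by
      rw [hZ.variance_increment, add_sub_cancel_left, hC]; ring
    have := ae_eq_integral_of_variance_eq_zero
      (hZ.hasGaussianLaw_increments (u + h) u u u).fst.memLp_two hv
    rw [hZ.integral_increment] at this
    filter_upwards [this] with ω hω
    exact sub_eq_zero.1 hω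
  have iter : ∀ n : ℕ, Z ((n : ℝ) • h) =ᵐ[P] Z 0 := by
    intro n
    induction n with
    | zero => simp
    | succ n ih =>
      have : ((n + 1 : ℕ) : ℝ) • h = (n : ℝ) • h + h := by push_cast; rw [add_smul, one_smul]
      rw [this]
      exact (step _).trans ih
  obtain ⟨n, hn⟩ := exists_nat_gt (R / ‖h‖)
  have hfar : C ((n : ℝ) • h) = 0 := by
    apply hR
    rw [norm_smul, Real.norm_natCast]
    exact (div_lt_iff₀ (norm_pos_iff.2 hh)).1 hn
  have hv := hZ.variance_increment ((n : ℝ) • h) 0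
  have hz : (fun ω => Z ((n : ℝ) • h) ω - Z 0 ω) =ᵐ[P] 0 := by
    filter_upwards [iter n] with ω hω
    simp [hω]
  rw [variance_congr hz, variance_zero, sub_zero, hfar] at hv
  exact h0 (by linarith)

/-- The increment is Gaussian with non-zero variance `2 * (C 0 - C (x - y))`, so it has no atom at
0. -/
theorem ae_ne (hZ : IsCentredStationaryGaussianField P Z C) {R : ℝ}
    (hR : ∀ h, R < ‖h‖ → C h = 0) (h0 : C 0 ≠ 0) {x y : Plane} (hxy : x ≠ y) :
    ∀ᵐ ω ∂P, Z x ω ≠ Z y ω := by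
  have hlaw := (hZ.hasGaussianLaw_increments x y x y).fst
  have hmap := hlaw.map_eq_gaussianReal
  have hv : Var[fun ω => Z x ω - Z y ω; P].toNNReal ≠ 0 := by
    have h1 := hZ.variance_increment x y
    have h2 := hZ.covarianceFunction_ne hR h0 (sub_ne_zero.2 hxy)
    have h3 := variance_nonneg (fun ω => Z x ω - Z y ω) P
    have h4 : Var[fun ω => Z x ω - Z y ω; P] ≠ 0 := by
      rw [h1]
      exact mul_ne_zero two_ne_zero (sub_ne_zero.2 h2.symm)
    exact (Real.toNNReal_pos.2 (lt_of_le_of_ne h3 h4.symm)).ne'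
  have := nullSingletonClass_gaussianReal (μ := P[fun ω => Z x ω - Z y ω]) hv
  have hz : P.map (fun ω => Z x ω - Z y ω) {0} = 0 := by
    rw [hmap]; exact measure_singleton 0
  rw [Measure.map_apply_of_aemeasurable hlaw.aemeasurable (measurableSet_singleton 0)] at hz
  filter_upwards [compl_mem_ae_iff.2 hz] with ω hω h
  exact hω (sub_eq_zero.2 h)

/-- Exchanging the two points preserves the law of the increment but reverses its sign. -/
theorem integral_signDiff (hZ : IsCentredStationaryGaussianField P Z C) (x y : Plane) :
    ∫ ω, signDiff (fun u => Z u ω) x y ∂P = 0 := by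
  have h1 := (hZ.hasGaussianLaw_increments x y x y).fst
  have h2 := (hZ.hasGaussianLaw_increments y x y x).fst
  have hmap : P.map (fun ω => Z x ω - Z y ω) = P.map (fun ω => Z y ω - Z x ω) := by
    rw [h1.map_eq_gaussianReal, h2.map_eq_gaussianReal, hZ.integral_increment,
      hZ.integral_increment, hZ.variance_increment, hZ.variance_increment, ← neg_sub x y,
      hZ.covarianceFunction_neg]
  have h3 : ∫ ω, signDiff (fun u => Z u ω) x y ∂P = ∫ ω, signDiff (fun u => Z u ω) y x ∂P := by
    simp only [signDiff]
    rw [← integral_map (φ := fun ω => Z x ω - Z y ω) (f := Real.sign) h1.aemeasurable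
      measurable_sign.aestronglyMeasurable, hmap,
      integral_map h2.aemeasurable measurable_sign.aestronglyMeasurable]
  have h4 : ∫ ω, signDiff (fun u => Z u ω) x y ∂P = -∫ ω, signDiff (fun u => Z u ω) y x ∂P := by
    rw [← integral_neg]
    exact integral_congr_ae (Filter.Eventually.of_forall fun ω => signDiff_comm _ x y)
  linarith

end IsCentredStationaryGaussianField

/-! ### Means of products of two signs. -/

/-- The mean of `sgn(Z(x) - Z(y)) sgn(Z(u) - Z(v))`. -/
noncomputable def signCov {Ω : Type*} [MeasurableSpace Ω] (P : Measure Ω) (Z : Plane → Ω → ℝ)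
    (x y u v : Plane) : ℝ :=
  ∫ ω, signDiff (fun w => Z w ω) x y * signDiff (fun w => Z w ω) u v ∂P

namespace IsCentredStationaryGaussianField

variable {Ω : Type*} [MeasurableSpace Ω] {P : Measure Ω} [IsProbabilityMeasure P]
  {Z Z' : Plane → Ω → ℝ} {C : Plane → ℝ}

/-- The covariance function fixes the law of a pair of increments. This turns the product of the
expectations for `Z₁` and `Z₂` into a square, the source of all positivity below. -/
theorem signCov_eq (hZ : IsCentredStationaryGaussianField P Z C)
    (hZ' : IsCentredStationaryGaussianField P Z' C) (x y u v : Plane) :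
    signCov P Z x y u v = signCov P Z' x y u v := by
  have h1 := hZ.hasGaussianLaw_increments x y u v
  have h2 := hZ'.hasGaussianLaw_increments x y u v
  have hmap := map_prodMk_eq_of_covariance_eq h1 h2 (hZ.integral_increment _ _)
    (hZ.integral_increment _ _) (hZ'.integral_increment _ _) (hZ'.integral_increment _ _)
    (by rw [hZ.covariance_increments, hZ'.covariance_increments])
    (by rw [hZ.covariance_increments, hZ'.covariance_increments])
    (by rw [hZ.covariance_increments, hZ'.covariance_increments])
  have hm : Measurable fun p : ℝ × ℝ => Real.sign p.1 * Real.sign p.2 :=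
    (measurable_sign.comp measurable_fst).mul (measurable_sign.comp measurable_snd)
  simp only [signCov, signDiff]
  rw [← integral_map (φ := fun ω => (Z x ω - Z y ω, Z u ω - Z v ω))
    (f := fun p : ℝ × ℝ => Real.sign p.1 * Real.sign p.2) h1.aemeasurable
    hm.aestronglyMeasurable, hmap, integral_map h2.aemeasurable hm.aestronglyMeasurable]

/-- Uncorrelated jointly Gaussian increments are independent, and each sign has mean zero. -/
theorem signCov_eq_zero (hZ : IsCentredStationaryGaussianField P Z C) {x y u v : Plane}
    (hxu : C (x - u) = 0) (hxv : C (x - v) = 0) (hyu : C (y - u) = 0) (hyv : C (y - v) = 0) :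
    signCov P Z x y u v = 0 := by
  have h1 := hZ.hasGaussianLaw_increments x y u v
  have hind := h1.indepFun_of_covariance_eq_zero
    (by rw [hZ.covariance_increments, hxu, hxv, hyu, hyv]; ring)
  have := (hind.comp measurable_sign measurable_sign).integral_fun_mul_eq_mul_integral
    (measurable_sign.comp_aemeasurable h1.fst.aemeasurable).aestronglyMeasurable
    (measurable_sign.comp_aemeasurable h1.snd.aemeasurable).aestronglyMeasurable
  have h0 := hZ.integral_signDiff x y
  simp only [signDiff] at h0
  simp only [Function.comp_apply, h0, zero_mul] at this
  exact this

theorem integrable_signDiff_mul (hZ : IsCentredStationaryGaussianField P Z C) (x y u v : Plane) :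
    Integrable (fun ω => signDiff (fun w => Z w ω) x y * signDiff (fun w => Z w ω) u v) P := by
  refine Integrable.of_bound ((hZ.aestronglyMeasurable_signDiff x y).mul
    (hZ.aestronglyMeasurable_signDiff u v)) 1 (Filter.Eventually.of_forall fun ω => ?_)
  rw [norm_mul]
  exact mul_le_one₀ (abs_signDiff_le_one _ _ _) (norm_nonneg _) (abs_signDiff_le_one _ _ _)

theorem signCov_self (hZ : IsCentredStationaryGaussianField P Z C) {R : ℝ}
    (hR : ∀ h, R < ‖h‖ → C h = 0) (h0 : C 0 ≠ 0) {x y : Plane} (hxy : x ≠ y) :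
    signCov P Z x y x y = 1 := by
  have : (fun ω => signDiff (fun w => Z w ω) x y * signDiff (fun w => Z w ω) x y) =ᵐ[P]
      fun _ => 1 := by
    filter_upwards [hZ.ae_ne hR h0 hxy] with ω hω
    simp only [signDiff]
    rcases lt_or_gt_of_ne hω with h | h
    · rw [Real.sign_of_neg (sub_neg.2 h)]; norm_num
    · rw [Real.sign_of_pos (sub_pos.2 h)]; norm_num
  rw [signCov, integral_congr_ae this]
  simp

theorem sum_signCov (hZ : IsCentredStationaryGaussianField P Z C) {R : ℝ}
    (hR : ∀ h, R < ‖h‖ → C h = 0) (h0 : C 0 ≠ 0) {x y v : Plane} (hxy : x ≠ y) :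
    signCov P Z x y x v + signCov P Z y x y v + signCov P Z v x v y = 1 := by
  have i12 : Integrable (fun ω => signDiff (fun w => Z w ω) x y * signDiff (fun w => Z w ω) x v +
      signDiff (fun w => Z w ω) y x * signDiff (fun w => Z w ω) y v) P :=
    (hZ.integrable_signDiff_mul x y x v).add (hZ.integrable_signDiff_mul y x y v)
  simp only [signCov]
  rw [← integral_add (hZ.integrable_signDiff_mul _ _ _ _) (hZ.integrable_signDiff_mul _ _ _ _),
    ← integral_add i12 (hZ.integrable_signDiff_mul _ _ _ _)]
  have : (fun ω => signDiff (fun w => Z w ω) x y * signDiff (fun w => Z w ω) x v +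
      signDiff (fun w => Z w ω) y x * signDiff (fun w => Z w ω) y v +
      signDiff (fun w => Z w ω) v x * signDiff (fun w => Z w ω) v y) =ᵐ[P] fun _ => 1 := by
    filter_upwards [hZ.ae_ne hR h0 hxy] with ω hω
    exact sum_signDiff_eq_one (fun w => Z w ω) hω
  refine (integral_congr_ae this).trans ?_
  simp

end IsCentredStationaryGaussianField

theorem abs_signCov_le_one {Ω : Type*} [MeasurableSpace Ω] (P : Measure Ω)
    [IsProbabilityMeasure P] (Z : Plane → Ω → ℝ) (x y u v : Plane) :
    |signCov P Z x y u v| ≤ 1 := by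
  have := norm_integral_le_of_norm_le_const (μ := P) (C := 1)
    (f := fun ω => signDiff (fun w => Z w ω) x y * signDiff (fun w => Z w ω) u v)
    (Filter.Eventually.of_forall fun ω => by
      rw [norm_mul]
      exact mul_le_one₀ (abs_signDiff_le_one _ _ _) (norm_nonneg _) (abs_signDiff_le_one _ _ _))
  simpa [signCov] using this

/-! ### Factorial moment measures compared with Lebesgue measure on the window. -/

/-- The factorial moment measure with density `ρ`, restricted to tuples of points of `W`. -/
noncomputable def momentMeasure {k : ℕ} (ρ : (Fin k → Plane) → ℝ) (W : Set Plane) :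
    Measure (Fin k → Plane) :=
  (volume.withDensity fun x => ENNReal.ofReal (ρ x)).restrict (Set.pi Set.univ fun _ => W)

/-- Lebesgue measure on the `k`-tuples of points of `W`. -/
noncomputable def windowMeasure (k : ℕ) (W : Set Plane) : Measure (Fin k → Plane) :=
  Measure.pi fun _ => volume.restrict W

theorem windowMeasure_eq_restrict (k : ℕ) (W : Set Plane) :
    windowMeasure k W = volume.restrict (Set.pi Set.univ fun _ => W) := by
  rw [windowMeasure, volume_pi, Measure.restrict_pi_pi]

theorem isFiniteMeasure_windowMeasure (k : ℕ) {W : Set Plane} (hW : IsCompact W) :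
    IsFiniteMeasure (windowMeasure k W) := by
  have : IsFiniteMeasure (volume.restrict W) := ⟨by
    rw [Measure.restrict_apply_univ]; exact hW.measure_lt_top⟩
  unfold windowMeasure
  infer_instance

theorem measureReal_windowMeasure_univ (k : ℕ) (W : Set Plane) :
    (windowMeasure k W).real Set.univ = area W ^ k := by
  rw [windowMeasure_eq_restrict, Measure.real, Measure.restrict_apply_univ, volume_pi_pi]
  simp [area]

theorem momentMeasure_apply {k : ℕ} (ρ : (Fin k → Plane) → ℝ) {W : Set Plane}
    (hW : MeasurableSet W) {D : Set (Fin k → Plane)} (hD : MeasurableSet D) :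
    momentMeasure ρ W D =
      ∫⁻ x in D ∩ Set.pi Set.univ fun _ => W, ENNReal.ofReal (ρ x) := by
  rw [momentMeasure, Measure.restrict_apply hD,
    withDensity_apply _ (hD.inter (MeasurableSet.univ_pi fun _ => hW))]

theorem momentMeasure_le {k : ℕ} {ρ : (Fin k → Plane) → ℝ} {M : ℝ} (hM : ∀ᵐ x, ρ x ≤ M)
    {W : Set Plane} (hW : MeasurableSet W) :
    momentMeasure ρ W ≤ ENNReal.ofReal M • windowMeasure k W := by
  refine Measure.le_iff.2 fun D hD => ?_
  rw [momentMeasure_apply ρ hW hD, windowMeasure_eq_restrict, Measure.smul_apply,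
    Measure.restrict_apply hD, smul_eq_mul, ← setLIntegral_const]
  exact lintegral_mono_ae (ae_restrict_of_ae (hM.mono fun x hx => ENNReal.ofReal_le_ofReal hx))

theorem le_momentMeasure {k : ℕ} {ρ : (Fin k → Plane) → ℝ} {m : ℝ} (hm : ∀ᵐ x, m ≤ ρ x)
    {W : Set Plane} (hW : MeasurableSet W) :
    ENNReal.ofReal m • windowMeasure k W ≤ momentMeasure ρ W := by
  refine Measure.le_iff.2 fun D hD => ?_
  rw [momentMeasure_apply ρ hW hD, windowMeasure_eq_restrict, Measure.smul_apply,
    Measure.restrict_apply hD, smul_eq_mul, ← setLIntegral_const]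
  exact lintegral_mono_ae (ae_restrict_of_ae (hm.mono fun x hx => ENNReal.ofReal_le_ofReal hx))

theorem isFiniteMeasure_momentMeasure {k : ℕ} {ρ : (Fin k → Plane) → ℝ} {M : ℝ}
    (hM : ∀ᵐ x, ρ x ≤ M) {W : Set Plane} (hW : IsCompact W) :
    IsFiniteMeasure (momentMeasure ρ W) := by
  have := isFiniteMeasure_windowMeasure k hW
  exact ⟨(momentMeasure_le hM hW.measurableSet Set.univ).trans_lt (by
    rw [Measure.smul_apply, smul_eq_mul]
    exact ENNReal.mul_lt_top ENNReal.ofReal_lt_top (measure_lt_top _ _))⟩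

theorem integral_momentMeasure_le {k : ℕ} {ρ : (Fin k → Plane) → ℝ} {M : ℝ} (hM0 : 0 ≤ M)
    (hM : ∀ᵐ x, ρ x ≤ M) {W : Set Plane} (hW : IsCompact W) {h : (Fin k → Plane) → ℝ}
    (hh : Integrable h (windowMeasure k W)) (h0 : ∀ x, 0 ≤ h x) :
    ∫ x, h x ∂(momentMeasure ρ W) ≤ M * ∫ x, h x ∂(windowMeasure k W) := by
  have := integral_mono_measure (momentMeasure_le hM hW.measurableSet)
    (Filter.Eventually.of_forall h0) (hh.smul_measure ENNReal.ofReal_ne_top)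
  rwa [integral_smul_measure, ENNReal.toReal_ofReal hM0] at this

/-- The upper bound on `ρ` secures integrability of `h` for the moment measure; otherwise the
Bochner integral on the right could take its default value 0. -/
theorem le_integral_momentMeasure {k : ℕ} {ρ : (Fin k → Plane) → ℝ} {m M : ℝ} (hm0 : 0 ≤ m)
    (hm : ∀ᵐ x, m ≤ ρ x) (hM : ∀ᵐ x, ρ x ≤ M) {W : Set Plane} (hW : IsCompact W)
    {h : (Fin k → Plane) → ℝ} (hh : Integrable h (windowMeasure k W)) (h0 : ∀ x, 0 ≤ h x) :
    m * ∫ x, h x ∂(windowMeasure k W) ≤ ∫ x, h x ∂(momentMeasure ρ W) := by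
  have hh' : Integrable h (momentMeasure ρ W) :=
    (hh.smul_measure ENNReal.ofReal_ne_top).mono_measure (momentMeasure_le hM hW.measurableSet)
  have := integral_mono_measure (le_momentMeasure hm hW.measurableSet)
    (Filter.Eventually.of_forall h0) hh'
  rwa [integral_smul_measure, ENNReal.toReal_ofReal hm0] at this

/-! ### Means of sums over distinct points. -/

theorem lintegral_countingMeasure_distinctTuples {Ω : Type*} [MeasurableSpace Ω] {P : Measure Ω}
    {Φ : Ω → Set Plane} {k : ℕ} {ρ : (Fin k → Plane) → ℝ} (hρ : IsProductDensity P Φ k ρ)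
    {W : Set Plane} (hW : MeasurableSet W) {D : Set (Fin k → Plane)} (hD : MeasurableSet D) :
    ∫⁻ ω, countingMeasure (distinctTuples k (Φ ω) W) D ∂P = momentMeasure ρ W D := by
  rw [momentMeasure_apply ρ hW hD, ← hρ.2 _ (hD.inter (MeasurableSet.univ_pi fun _ => hW))]
  refine lintegral_congr fun ω => ?_
  rw [countingMeasure_apply _ hD]
  congr 1
  ext x
  simp only [distinctTuples, Set.mem_inter_iff, Set.mem_ofPred_eq, Set.mem_pi, Set.mem_univ,
    forall_true_left]
  constructor
  · rintro ⟨h1, h2, h3⟩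
    exact ⟨⟨h1, fun i => (h3 i).2⟩, h2, fun i => (h3 i).1⟩
  · rintro ⟨⟨h1, h2⟩, h3, h4⟩
    exact ⟨h1, h3, fun i => ⟨h4 i, h2 i⟩⟩

theorem measurable_signDiff_eval {Ω : Type*} {m : MeasurableSpace Ω} {Z : Plane → Ω → ℝ}
    (hZ : Measurable fun p : Ω × Plane => Z p.2 p.1) {k : ℕ} (i j : Fin k) :
    Measurable fun p : Ω × (Fin k → Plane) => signDiff (fun u => Z u p.1) (p.2 i) (p.2 j) := by
  have h : ∀ i : Fin k, Measurable fun p : Ω × (Fin k → Plane) => Z (p.2 i) p.1 := fun i =>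
    hZ.comp (measurable_fst.prodMk ((measurable_pi_apply i).comp measurable_snd))
  exact measurable_sign.comp ((h i).sub (h j))

/-- Sums over distinct points of a point process of products of two independent random functions
that are independent of the process. -/
theorem integral_sum_distinctTuples {Ω : Type*} {m₀ m₁ m₂ mΩ : MeasurableSpace Ω}
    {P : Measure Ω} [IsProbabilityMeasure P] (h₀ : m₀ ≤ mΩ) (h₁ : m₁ ≤ mΩ) (h₂ : m₂ ≤ mΩ)
    (hind : Indep m₀ (m₁ ⊔ m₂) P) (hind' : Indep m₁ m₂ P) {Φ : Ω → Set Plane}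
    (hΦ : Measurable[m₀] fun ω => countingMeasure (Φ ω)) {W : Set Plane} (hW : IsCompact W)
    (hfin : ∀ ω, (Φ ω ∩ W).Finite) {k : ℕ} {ρ : (Fin k → Plane) → ℝ}
    (hρ : IsProductDensity P Φ k ρ) {M : ℝ} (hM : ∀ᵐ x, ρ x ≤ M)
    {f g : Ω × (Fin k → Plane) → ℝ} (hf : Measurable[m₁.prod inferInstance] f)
    (hg : Measurable[m₂.prod inferInstance] g) (hf1 : ∀ p, |f p| ≤ 1) (hg1 : ∀ p, |g p| ≤ 1) :
    Integrable (fun ω =>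
        ∫ x, f (ω, x) * g (ω, x) ∂(countingMeasure (distinctTuples k (Φ ω) W))) P ∧
      ∫ ω, ∫ x, f (ω, x) * g (ω, x) ∂(countingMeasure (distinctTuples k (Φ ω) W)) ∂P =
        ∫ x, (∫ ω, f (ω, x) ∂P) * ∫ ω, g (ω, x) ∂P ∂(momentMeasure ρ W) := by
  have := isFiniteMeasure_momentMeasure hM hW
  have hle : ∀ {m : MeasurableSpace Ω}, m ≤ m₁ ⊔ m₂ →
      m.prod (inferInstance : MeasurableSpace (Fin k → Plane)) ≤ (m₁ ⊔ m₂).prod inferInstance :=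
    fun h => sup_le_sup (MeasurableSpace.comap_mono h) le_rfl
  have hmeas : Measurable[(m₁ ⊔ m₂).prod inferInstance] fun p => f p * g p :=
    (hf.mono (hle le_sup_left) le_rfl).mul (hg.mono (hle le_sup_right) le_rfl)
  obtain ⟨hI, hE⟩ := integral_compProd_of_indep h₀ (sup_le h₁ h₂) hind
    (fun ω => countingMeasure (distinctTuples k (Φ ω) W))
    (measurable_countingMeasure_distinctTuples hW.measurableSet hfin hΦ k)
    (fun ω => isFiniteMeasure_countingMeasure (distinctTuples_finite (hfin ω)))
    (momentMeasure ρ W)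
    (fun D hD => lintegral_countingMeasure_distinctTuples hρ hW.measurableSet hD)
    (fun p => f p * g p) hmeas 1 (fun p => by
      rw [abs_mul]; exact mul_le_one₀ (hf1 p) (abs_nonneg _) (hg1 p))
  refine ⟨hI, hE.trans (integral_congr_ae (Filter.Eventually.of_forall fun x => ?_))⟩
  have hfx : Measurable[m₁] fun ω => f (ω, x) := hf.comp measurable_prodMk_right
  have hgx : Measurable[m₂] fun ω => g (ω, x) := hg.comp measurable_prodMk_right
  have hfg : IndepFun (fun ω => f (ω, x)) (fun ω => g (ω, x)) P := by
    rw [IndepFun_iff_Indep]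
    exact indep_of_indep_of_le_left (indep_of_indep_of_le_right hind' hgx.comap_le) hfx.comap_le
  exact hfg.integral_fun_mul_eq_mul_integral
    (hfx.mono h₁ le_rfl).aestronglyMeasurable (hgx.mono h₂ le_rfl).aestronglyMeasurable

/-! ### Close pairs and permutations of coordinates in the window. -/

/-- By Fubini: with all coordinates but `x i` fixed, `x i` ranges over part of a ball of radius `R`
about `x j`. One factor `|W|` is thus replaced by a constant. -/
theorem windowMeasure_dist_le (n : ℕ) {W : Set Plane} (hW : IsCompact W) (R : ℝ)
    {i j : Fin (n + 1)} (hij : i ≠ j) :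
    windowMeasure (n + 1) W {x | dist (x i) (x j) ≤ R} ≤
      windowMeasure n W Set.univ * volume (Metric.closedBall (0 : Plane) R) := by
  have hfin : IsFiniteMeasure (volume.restrict W) := ⟨by
    rw [Measure.restrict_apply_univ]; exact hW.measure_lt_top⟩
  have := isFiniteMeasure_windowMeasure n hW
  obtain ⟨j', rfl⟩ := Fin.exists_succAbove_eq hij.symm
  have hmp := measurePreserving_piFinSuccAbove (fun _ : Fin (n + 1) => (volume.restrict W)) i
  have hm : MeasurableSet {p : Plane × (Fin n → Plane) | dist p.1 (p.2 j') ≤ R} :=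
    measurableSet_le (measurable_fst.dist ((measurable_pi_apply j').comp measurable_snd))
      measurable_const
  have hpre := hmp.measure_preimage hm.nullMeasurableSet
  have hset : (MeasurableEquiv.piFinSuccAbove (fun _ => Plane) i) ⁻¹'
      {p : Plane × (Fin n → Plane) | dist p.1 (p.2 j') ≤ R} =
      {x | dist (x i) (x (i.succAbove j')) ≤ R} := rfl
  rw [hset] at hpre
  refine (le_of_eq hpre).trans ?_
  rw [Measure.prod_apply_symm hm]
  refine (lintegral_mono (g := fun _ => volume (Metric.closedBall (0 : Plane) R)) fun q => ?_).trans
    (le_of_eq ?_)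
  · refine (Measure.restrict_apply_le _ _).trans ?_
    rw [← Measure.addHaar_closedBall_center volume (q j') R]
    exact le_of_eq rfl
  · rw [lintegral_const, mul_comm]
    rfl

/-- The case `R = 0` of the previous bound, where the ball is a null singleton. -/
theorem ae_ne_windowMeasure (n : ℕ) {W : Set Plane} (hW : IsCompact W) {i j : Fin (n + 1)}
    (hij : i ≠ j) : ∀ᵐ x ∂(windowMeasure (n + 1) W), x i ≠ x j := by
  have h := windowMeasure_dist_le n hW 0 hij
  rw [Metric.closedBall_zero, measure_singleton, mul_zero] at h
  have h0 := le_antisymm h zero_le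
  filter_upwards [compl_mem_ae_iff.2 h0] with x hx hxx
  exact hx (by simp [hxx])

theorem measureReal_windowMeasure_dist_le (n : ℕ) {W : Set Plane} (hW : IsCompact W) (R : ℝ)
    {i j : Fin (n + 1)} (hij : i ≠ j) :
    (windowMeasure (n + 1) W).real {x | dist (x i) (x j) ≤ R} ≤
      area W ^ n * volume.real (Metric.closedBall (0 : Plane) R) := by
  have := isFiniteMeasure_windowMeasure n hW
  rw [← measureReal_windowMeasure_univ, Measure.real, Measure.real, Measure.real,
    ← ENNReal.toReal_mul]
  exact ENNReal.toReal_mono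
    (ENNReal.mul_ne_top (measure_ne_top _ _) measure_closedBall_lt_top.ne)
    (windowMeasure_dist_le n hW R hij)

theorem integral_comp_perm_windowMeasure (k : ℕ) {W : Set Plane} (hW : IsCompact W)
    (σ : Equiv.Perm (Fin k)) (h : (Fin k → Plane) → ℝ) :
    ∫ x, h (fun i => x (σ i)) ∂(windowMeasure k W) = ∫ x, h x ∂(windowMeasure k W) := by
  have hfin : IsFiniteMeasure (volume.restrict W) := ⟨by
    rw [Measure.restrict_apply_univ]; exact hW.measure_lt_top⟩
  have := measurePreserving_arrowCongr' (fun _ : Fin k => (volume.restrict W))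
    (fun _ => volume.restrict W) σ.symm (MeasurableEquiv.refl Plane)
    (fun _ => MeasurePreserving.id _)
  exact this.integral_comp' h

/-! ### Integrals of `signCov ^ 2` over the window. -/

theorem measurable_signCov {Ω : Type*} [MeasurableSpace Ω] (P : Measure Ω)
    [IsProbabilityMeasure P] {Z : Plane → Ω → ℝ}
    (hZ : Measurable fun p : Ω × Plane => Z p.2 p.1) {k : ℕ} (a b c d : Fin k) :
    Measurable fun x : Fin k → Plane => signCov P Z (x a) (x b) (x c) (x d) := by
  have h : Measurable fun p : Ω × (Fin k → Plane) =>
      signDiff (fun u => Z u p.1) (p.2 a) (p.2 b) * signDiff (fun u => Z u p.1) (p.2 c) (p.2 d) :=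
    (measurable_signDiff_eval hZ a b).mul (measurable_signDiff_eval hZ c d)
  exact h.stronglyMeasurable.integral_prod_left'.measurable

theorem signCov_sq_le_one {Ω : Type*} [MeasurableSpace Ω] (P : Measure Ω)
    [IsProbabilityMeasure P] (Z : Plane → Ω → ℝ) (x y u v : Plane) :
    signCov P Z x y u v ^ 2 ≤ 1 :=
  (sq_le_one_iff_abs_le_one _).2 (abs_signCov_le_one P Z x y u v)

theorem integrable_signCov_sq {Ω : Type*} [MeasurableSpace Ω] (P : Measure Ω)
    [IsProbabilityMeasure P] {Z : Plane → Ω → ℝ}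
    (hZ : Measurable fun p : Ω × Plane => Z p.2 p.1) {k : ℕ} (a b c d : Fin k)
    (μ : Measure (Fin k → Plane)) [IsFiniteMeasure μ] :
    Integrable (fun x => signCov P Z (x a) (x b) (x c) (x d) ^ 2) μ :=
  Integrable.of_bound ((measurable_signCov P hZ a b c d).pow_const 2).aestronglyMeasurable 1
    (Filter.Eventually.of_forall fun x => by
      rw [Real.norm_of_nonneg (sq_nonneg _)]
      exact signCov_sq_le_one _ _ _ _ _ _)

theorem integral_signCov_sq_le {Ω : Type*} [MeasurableSpace Ω] (P : Measure Ω)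
    [IsProbabilityMeasure P] {Z : Plane → Ω → ℝ}
    (hZ : Measurable fun p : Ω × Plane => Z p.2 p.1) {k : ℕ} (a b c d : Fin k)
    {W : Set Plane} (hW : IsCompact W) :
    ∫ x, signCov P Z (x a) (x b) (x c) (x d) ^ 2 ∂(windowMeasure k W) ≤ area W ^ k := by
  have := isFiniteMeasure_windowMeasure k hW
  refine (integral_mono (integrable_signCov_sq P hZ a b c d _) (integrable_const 1)
    fun x => signCov_sq_le_one P Z _ _ _ _).trans (le_of_eq ?_)
  rw [integral_const, measureReal_windowMeasure_univ, smul_eq_mul, mul_one]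

namespace IsCentredStationaryGaussianField

variable {Ω : Type*} [MeasurableSpace Ω] {P : Measure Ω} [IsProbabilityMeasure P]
  {Z : Plane → Ω → ℝ} {C : Plane → ℝ} {R : ℝ} {W : Set Plane}

theorem integral_signCov_sq_four_le (hZ : IsCentredStationaryGaussianField P Z C)
    (hm : Measurable fun p : Ω × Plane => Z p.2 p.1) (hR : ∀ h, R < ‖h‖ → C h = 0)
    (hW : IsCompact W) :
    ∫ x, signCov P Z (x 0) (x 1) (x 2) (x 3) ^ 2 ∂(windowMeasure 4 W) ≤
      4 * (area W ^ 3 * volume.real (Metric.closedBall (0 : Plane) R)) := by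
  have := isFiniteMeasure_windowMeasure 4 hW
  let E : Fin 4 → Fin 4 → Set (Fin 4 → Plane) := fun i j => {x | dist (x i) (x j) ≤ R}
  have hE : ∀ i j, MeasurableSet (E i j) := fun i j =>
    measurableSet_le ((measurable_pi_apply i).dist (measurable_pi_apply j)) measurable_const
  have hbound : ∀ i j : Fin 4, i ≠ j → ∫ x, (E i j).indicator (fun _ => (1 : ℝ)) x
      ∂(windowMeasure 4 W) ≤ area W ^ 3 * volume.real (Metric.closedBall (0 : Plane) R) := by
    intro i j hij
    rw [integral_indicator_const _ (hE i j), smul_eq_mul, mul_one]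
    exact measureReal_windowMeasure_dist_le 3 hW R hij
  have hint : ∀ i j, Integrable ((E i j).indicator fun _ => (1 : ℝ)) (windowMeasure 4 W) :=
    fun i j => (integrable_const _).indicator (hE i j)
  have hpt : ∀ x : Fin 4 → Plane, signCov P Z (x 0) (x 1) (x 2) (x 3) ^ 2 ≤
      (E 0 2).indicator (fun _ => (1 : ℝ)) x + (E 0 3).indicator (fun _ => (1 : ℝ)) x +
        ((E 1 2).indicator (fun _ => (1 : ℝ)) x + (E 1 3).indicator (fun _ => (1 : ℝ)) x) := by
    intro x
    have hnn : ∀ i j, 0 ≤ (E i j).indicator (fun _ => (1 : ℝ)) x := fun i j =>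
      Set.indicator_nonneg (fun _ _ => zero_le_one) x
    have h1 := signCov_sq_le_one P Z (x 0) (x 1) (x 2) (x 3)
    have a1 := hnn 0 2
    have a2 := hnn 0 3
    have a3 := hnn 1 2
    have a4 := hnn 1 3
    -- Either some cross pair is close, and one indicator dominates the square, which is at most 1;
    -- or all four cross covariances vanish and so does `signCov`.
    by_cases hx : x ∈ E 0 2 ∪ E 0 3 ∪ (E 1 2 ∪ E 1 3)
    · rcases hx with (h | h) | (h | h)
      · have := Set.indicator_of_mem h fun _ => (1 : ℝ)
        linarith
      · have := Set.indicator_of_mem h fun _ => (1 : ℝ)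
        linarith
      · have := Set.indicator_of_mem h fun _ => (1 : ℝ)
        linarith
      · have := Set.indicator_of_mem h fun _ => (1 : ℝ)
        linarith
    · have hC : ∀ i j, x ∉ E i j → C (x i - x j) = 0 := fun i j h => hR _ (by
        rw [← dist_eq_norm]; exact not_le.1 h)
      simp only [Set.mem_union, not_or] at hx
      rw [hZ.signCov_eq_zero (hC _ _ hx.1.1) (hC _ _ hx.1.2) (hC _ _ hx.2.1) (hC _ _ hx.2.2)]
      linarith
  have hsum := integral_mono (integrable_signCov_sq P hm 0 1 2 3 _)
    (((hint 0 2).add (hint 0 3)).add ((hint 1 2).add (hint 1 3))) hpt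
  have e : ∫ x, ((E 0 2).indicator (fun _ => (1 : ℝ)) x + (E 0 3).indicator (fun _ => (1 : ℝ)) x +
        ((E 1 2).indicator (fun _ => (1 : ℝ)) x + (E 1 3).indicator (fun _ => (1 : ℝ)) x))
        ∂(windowMeasure 4 W) =
      ∫ x, (E 0 2).indicator (fun _ => (1 : ℝ)) x ∂(windowMeasure 4 W) +
        ∫ x, (E 0 3).indicator (fun _ => (1 : ℝ)) x ∂(windowMeasure 4 W) +
        (∫ x, (E 1 2).indicator (fun _ => (1 : ℝ)) x ∂(windowMeasure 4 W) +
        ∫ x, (E 1 3).indicator (fun _ => (1 : ℝ)) x ∂(windowMeasure 4 W)) := by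
    rw [← integral_add (hint _ _) (hint _ _), ← integral_add (hint _ _) (hint _ _)]
    exact integral_add ((hint 0 2).add (hint 0 3)) ((hint 1 2).add (hint 1 3))
  have b1 := hbound 0 2 (by decide)
  have b2 := hbound 0 3 (by decide)
  have b3 := hbound 1 2 (by decide)
  have b4 := hbound 1 3 (by decide)
  refine hsum.trans ?_
  refine (le_of_eq e).trans ?_
  linarith

/-- The three vertices of a triangle play the same role under Lebesgue measure, so each carries a
third of the integral of the sum of squares, which is at least 1/3 almost everywhere. -/
theorem le_integral_signCov_sq_three (hZ : IsCentredStationaryGaussianField P Z C)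
    (hm : Measurable fun p : Ω × Plane => Z p.2 p.1) (hR : ∀ h, R < ‖h‖ → C h = 0)
    (h0 : C 0 ≠ 0) (hW : IsCompact W) :
    area W ^ 3 / 9 ≤
      ∫ x, signCov P Z (x 0) (x 1) (x 0) (x 2) ^ 2 ∂(windowMeasure 3 W) := by
  have := isFiniteMeasure_windowMeasure 3 hW
  have i1 := integrable_signCov_sq P hm (k := 3) 0 1 0 2 (windowMeasure 3 W)
  have i2 := integrable_signCov_sq P hm (k := 3) 1 0 1 2 (windowMeasure 3 W)
  have i3 := integrable_signCov_sq P hm (k := 3) 2 0 2 1 (windowMeasure 3 W)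
  have e2 : ∫ x, signCov P Z (x 1) (x 0) (x 1) (x 2) ^ 2 ∂(windowMeasure 3 W) =
      ∫ x, signCov P Z (x 0) (x 1) (x 0) (x 2) ^ 2 ∂(windowMeasure 3 W) :=
    integral_comp_perm_windowMeasure 3 hW (Equiv.swap 0 1)
      fun x => signCov P Z (x 0) (x 1) (x 0) (x 2) ^ 2
  have e3 : ∫ x, signCov P Z (x 2) (x 0) (x 2) (x 1) ^ 2 ∂(windowMeasure 3 W) =
      ∫ x, signCov P Z (x 0) (x 1) (x 0) (x 2) ^ 2 ∂(windowMeasure 3 W) :=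
    integral_comp_perm_windowMeasure 3 hW (finRotate 3).symm
      fun x => signCov P Z (x 0) (x 1) (x 0) (x 2) ^ 2
  have hae : ∀ᵐ x ∂(windowMeasure 3 W), (1 / 3 : ℝ) ≤
      signCov P Z (x 0) (x 1) (x 0) (x 2) ^ 2 + signCov P Z (x 1) (x 0) (x 1) (x 2) ^ 2 +
        signCov P Z (x 2) (x 0) (x 2) (x 1) ^ 2 := by
    filter_upwards [ae_ne_windowMeasure 2 hW (i := 0) (j := 1) (by decide)] with x hx
    have hs := hZ.sum_signCov hR h0 (v := x 2) hx
    generalize signCov P Z (x 0) (x 1) (x 0) (x 2) = a at hs ⊢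
    generalize signCov P Z (x 1) (x 0) (x 1) (x 2) = b at hs ⊢
    generalize signCov P Z (x 2) (x 0) (x 2) (x 1) = c at hs ⊢
    -- Cauchy–Schwarz for `a + b + c = 1`: the sum of squares is at least 1/3.
    nlinarith [sq_nonneg (a - b), sq_nonneg (b - c), sq_nonneg (a - c)]
  have hle := integral_mono_ae (integrable_const (1 / 3 : ℝ)) ((i1.add i2).add i3) hae
  have e : ∫ x, (((fun x : Fin 3 → Plane => signCov P Z (x 0) (x 1) (x 0) (x 2) ^ 2) +
      fun x : Fin 3 → Plane => signCov P Z (x 1) (x 0) (x 1) (x 2) ^ 2) +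
        fun x : Fin 3 → Plane => signCov P Z (x 2) (x 0) (x 2) (x 1) ^ 2) x ∂(windowMeasure 3 W) =
      3 * ∫ x, signCov P Z (x 0) (x 1) (x 0) (x 2) ^ 2 ∂(windowMeasure 3 W) := by
    rw [integral_add' (i1.add i2) i3, integral_add' i1 i2, e2, e3]
    ring
  rw [e, integral_const, measureReal_windowMeasure_univ, smul_eq_mul] at hle
  linarith

theorem integral_signCov_sq_two (hZ : IsCentredStationaryGaussianField P Z C)
    (hR : ∀ h, R < ‖h‖ → C h = 0) (h0 : C 0 ≠ 0) (hW : IsCompact W) :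
    ∫ x, signCov P Z (x 0) (x 1) (x 0) (x 1) ^ 2 ∂(windowMeasure 2 W) = area W ^ 2 := by
  have hae : (fun x : Fin 2 → Plane => signCov P Z (x 0) (x 1) (x 0) (x 1) ^ 2)
      =ᵐ[windowMeasure 2 W] fun _ => 1 := by
    filter_upwards [ae_ne_windowMeasure 1 hW (i := 0) (j := 1) (by decide)] with x hx
    rw [hZ.signCov_self hR h0 hx, one_pow]
  rw [integral_congr_ae hae, integral_const, measureReal_windowMeasure_univ, smul_eq_mul, mul_one]

end IsCentredStationaryGaussianField

/-! ### Moments of the statistic and the final estimates. -/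

theorem IsBoundedAboveBelow.exists_bounds {k : ℕ} {ρ : (Fin k → Plane) → ℝ}
    (h : IsBoundedAboveBelow ρ) :
    ∃ m M : ℝ, 0 < m ∧ m ≤ M ∧ (∀ᵐ x, m ≤ ρ x) ∧ ∀ᵐ x, ρ x ≤ M := by
  obtain ⟨m, M, hm, h⟩ := h
  obtain ⟨x, hx⟩ := h.exists
  exact ⟨m, M, hm, hx.1.trans hx.2, h.mono fun _ h => h.1, h.mono fun _ h => h.2⟩

/-- Mean, and variance split into the contributions of coinciding pairs and the rest, of the
Kendall statistic, and the mean of the number of pairs. -/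
theorem kendall_moments {Ω : Type*} [mΩ : MeasurableSpace Ω] (P : Measure Ω)
    [IsProbabilityMeasure P] {Φ : Ω → Set Plane} {Z₁ Z₂ : Plane → Ω → ℝ}
    (hlf : ∀ ω, IsLocallyFinite (Φ ω)) (hindep : AreIndependent P Φ Z₁ Z₂)
    {lam₂ : (Fin 2 → Plane) → ℝ} (hlam₂ : IsProductDensity P Φ 2 lam₂)
    {lam₃ : (Fin 3 → Plane) → ℝ} (hlam₃ : IsProductDensity P Φ 3 lam₃)
    {lam₄ : (Fin 4 → Plane) → ℝ} (hlam₄ : IsProductDensity P Φ 4 lam₄)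
    {m₂ M₂ m₃ M₃ M₄ : ℝ} (h₂ : 0 ≤ m₂) (h₂' : 0 ≤ M₂) (h₃ : 0 ≤ m₃) (h₃' : 0 ≤ M₃) (h₄' : 0 ≤ M₄)
    (hm₂ : ∀ᵐ x, m₂ ≤ lam₂ x) (hM₂ : ∀ᵐ x, lam₂ x ≤ M₂)
    (hm₃ : ∀ᵐ x, m₃ ≤ lam₃ x) (hM₃ : ∀ᵐ x, lam₃ x ≤ M₃) (hM₄ : ∀ᵐ x, lam₄ x ≤ M₄)
    {C : Plane → ℝ} (hZ₁ : IsCentredStationaryGaussianField P Z₁ C)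
    (hZ₂ : IsCentredStationaryGaussianField P Z₂ C) {R : ℝ} (hR : ∀ h, R < ‖h‖ → C h = 0)
    (h0 : C 0 ≠ 0) {W : Set Plane} (hW : IsCompact W) :
    MemLp (kendallSum Φ Z₁ Z₂ W) 2 P ∧ Integrable (pairCount Φ W) P ∧
      P[kendallSum Φ Z₁ Z₂ W] = 0 ∧
      (m₂ * area W ^ 2 ≤ P[pairCount Φ W] ∧ P[pairCount Φ W] ≤ M₂ * area W ^ 2) ∧
      ∃ A B : ℝ, Var[kendallSum Φ Z₁ Z₂ W; P] = A + B ∧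
        4 * (m₃ * (area W ^ 3 / 9)) ≤ A ∧
        A ≤ M₄ * (4 * (area W ^ 3 * volume.real (Metric.closedBall (0 : Plane) R))) +
          4 * (M₃ * area W ^ 3) ∧
        2 * (m₂ * area W ^ 2) ≤ B ∧ B ≤ 2 * (M₂ * area W ^ 2) := by
  obtain ⟨𝓐, hle, hI, hΦ, hz₁, hz₂⟩ := hindep
  have hfin : ∀ ω, (Φ ω ∩ W).Finite := fun ω => hlf ω W hW
  have hind : Indep (𝓐 0) (𝓐 1 ⊔ 𝓐 2) P := by
    have := indep_iSup_of_disjoint hle hI (S := {0}) (T := {1, 2}) (by simp)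
    rwa [iSup_singleton, iSup_pair] at this
  have hind' : Indep (𝓐 1) (𝓐 2) P := hI.indep (by decide)
  have hmeas : Measurable fun p : Ω × Plane => Z₁ p.2 p.1 :=
    hz₁.mono (sup_le_sup (MeasurableSpace.comap_mono (hle 1)) le_rfl) le_rfl
  have hone : ∀ a b : ℝ, |a| ≤ 1 → |b| ≤ 1 → |a * b| ≤ 1 := fun a b ha hb => by
    rw [abs_mul]; exact mul_le_one₀ ha (abs_nonneg _) hb
  have hs := fun (ω : Ω) (Z : Plane → Ω → ℝ) (x y : Plane) =>
    abs_signDiff_le_one (fun u => Z u ω) x y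
  -- means of products of two signs
  have quad : ∀ {k : ℕ} {ρ : (Fin k → Plane) → ℝ} (_ : IsProductDensity P Φ k ρ) {M : ℝ}
      (_ : ∀ᵐ x, ρ x ≤ M) (a b c d : Fin k),
      Integrable (fun ω => ∫ x, concordance Z₁ Z₂ ω (x a) (x b) * concordance Z₁ Z₂ ω (x c) (x d)
          ∂(countingMeasure (distinctTuples k (Φ ω) W))) P ∧
        ∫ ω, ∫ x, concordance Z₁ Z₂ ω (x a) (x b) * concordance Z₁ Z₂ ω (x c) (x d)
          ∂(countingMeasure (distinctTuples k (Φ ω) W)) ∂P =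
        ∫ x, signCov P Z₁ (x a) (x b) (x c) (x d) ^ 2 ∂(momentMeasure ρ W) := by
    intro k ρ hρ M hM a b c d
    have key := integral_sum_distinctTuples (hle 0) (hle 1) (hle 2) hind hind' hΦ hW hfin hρ hM
      ((measurable_signDiff_eval hz₁ a b).mul (measurable_signDiff_eval hz₁ c d))
      ((measurable_signDiff_eval hz₂ a b).mul (measurable_signDiff_eval hz₂ c d))
      (fun p => hone _ _ (hs _ _ _ _) (hs _ _ _ _)) (fun p => hone _ _ (hs _ _ _ _) (hs _ _ _ _))
    have e : ∀ ω (x : Fin k → Plane),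
        concordance Z₁ Z₂ ω (x a) (x b) * concordance Z₁ Z₂ ω (x c) (x d) =
        signDiff (fun u => Z₁ u ω) (x a) (x b) * signDiff (fun u => Z₁ u ω) (x c) (x d) *
          (signDiff (fun u => Z₂ u ω) (x a) (x b) * signDiff (fun u => Z₂ u ω) (x c) (x d)) := by
      intro ω x; simp only [concordance]; ring
    simp only [e]
    refine ⟨key.1, key.2.trans (integral_congr_ae (Filter.Eventually.of_forall fun x => ?_))⟩
    change signCov P Z₁ (x a) (x b) (x c) (x d) * signCov P Z₂ (x a) (x b) (x c) (x d) = _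
    rw [← hZ₁.signCov_eq hZ₂]
    exact (sq _).symm
  obtain ⟨i4, e4⟩ := quad hlam₄ hM₄ 0 1 2 3
  obtain ⟨i3, e3⟩ := quad hlam₃ hM₃ 0 1 0 2
  obtain ⟨i2, e2⟩ := quad hlam₂ hM₂ 0 1 0 1
  -- the statistic itself
  have hS := integral_sum_distinctTuples (hle 0) (hle 1) (hle 2) hind hind' hΦ hW hfin hlam₂ hM₂
    (measurable_signDiff_eval hz₁ 0 1) (measurable_signDiff_eval hz₂ 0 1)
    (fun p => hs _ _ _ _) (fun p => hs _ _ _ _)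
  have hSeq : ∀ ω, kendallSum Φ Z₁ Z₂ W ω = _ := fun ω => kendallSum_eq_integral Z₁ Z₂ (hfin ω)
  have hSint : Integrable (kendallSum Φ Z₁ Z₂ W) P :=
    hS.1.congr (Filter.Eventually.of_forall fun ω => (hSeq ω).symm)
  have hSmean : P[kendallSum Φ Z₁ Z₂ W] = 0 := by
    refine (integral_congr_ae (Filter.Eventually.of_forall hSeq)).trans (hS.2.trans ?_)
    simp [hZ₁.integral_signDiff]
  have hsq : (fun ω => kendallSum Φ Z₁ Z₂ W ω ^ 2) = _ :=
    funext fun ω => kendallSum_sq_eq Z₁ Z₂ (hfin ω)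
  simp only [sq (concordance Z₁ Z₂ _ _ _)] at hsq
  have hsqint : Integrable (fun ω => kendallSum Φ Z₁ Z₂ W ω ^ 2) P := by
    rw [hsq]
    exact (i4.add (i3.const_mul 4)).add (i2.const_mul 2)
  have hmem : MemLp (kendallSum Φ Z₁ Z₂ W) 2 P :=
    (memLp_two_iff_integrable_sq hSint.aestronglyMeasurable).2 hsqint
  have hvar : Var[kendallSum Φ Z₁ Z₂ W; P] =
      ∫ x, signCov P Z₁ (x 0) (x 1) (x 2) (x 3) ^ 2 ∂(momentMeasure lam₄ W) +
      4 * ∫ x, signCov P Z₁ (x 0) (x 1) (x 0) (x 2) ^ 2 ∂(momentMeasure lam₃ W) +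
      2 * ∫ x, signCov P Z₁ (x 0) (x 1) (x 0) (x 1) ^ 2 ∂(momentMeasure lam₂ W) := by
    rw [variance_of_integral_eq_zero hSint.aemeasurable hSmean, hsq,
      integral_add (by exact i4.add (i3.const_mul 4)) (i2.const_mul 2),
      integral_add i4 (i3.const_mul 4), integral_const_mul, integral_const_mul, e4, e3, e2]
  -- the number of pairs
  have hU := integral_sum_distinctTuples (hle 0) (hle 1) (hle 2) hind hind' hΦ hW hfin hlam₂ hM₂
    (f := fun _ => 1) (g := fun _ => 1) measurable_const measurable_const (fun p => by simp)
    (fun p => by simp)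
  simp only [mul_one] at hU
  have hUeq : ∀ ω, pairCount Φ W ω = _ := fun ω => pairCount_eq_integral (hfin ω)
  have hUint : Integrable (pairCount Φ W) P :=
    hU.1.congr (Filter.Eventually.of_forall fun ω => (hUeq ω).symm)
  have hUmean : P[pairCount Φ W] = ∫ _, (1 : ℝ) ∂(momentMeasure lam₂ W) := by
    refine (integral_congr_ae (Filter.Eventually.of_forall hUeq)).trans (hU.2.trans ?_)
    simp
  have f2 := isFiniteMeasure_windowMeasure 2 hW
  have f3 := isFiniteMeasure_windowMeasure 3 hW
  have f4 := isFiniteMeasure_windowMeasure 4 hW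
  have j4 := integrable_signCov_sq P hmeas (k := 4) 0 1 2 3 (windowMeasure 4 W)
  have j3 := integrable_signCov_sq P hmeas (k := 3) 0 1 0 2 (windowMeasure 3 W)
  have j2 := integrable_signCov_sq P hmeas (k := 2) 0 1 0 1 (windowMeasure 2 W)
  have hone2 : ∫ _, (1 : ℝ) ∂(windowMeasure 2 W) = area W ^ 2 := by
    rw [integral_const, measureReal_windowMeasure_univ, smul_eq_mul, mul_one]
  -- The sum in `hvar` associates to the left, so unification takes the quadruple and triple terms
  -- as `A` and the pair term as `B`.
  refine ⟨hmem, hUint, hSmean, ⟨?_, ?_⟩, _, _, hvar, ?_, ?_, ?_, ?_⟩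
  · rw [hUmean, ← hone2]
    exact le_integral_momentMeasure h₂ hm₂ hM₂ hW (integrable_const _) fun _ => zero_le_one
  · rw [hUmean, ← hone2]
    exact integral_momentMeasure_le h₂' hM₂ hW (integrable_const _) fun _ => zero_le_one
  · have a := le_integral_momentMeasure h₃ hm₃ hM₃ hW j3 fun _ => sq_nonneg _
    have b := mul_le_mul_of_nonneg_left
      (hZ₁.le_integral_signCov_sq_three hmeas hR h0 hW) h₃
    have c : 0 ≤ ∫ x, signCov P Z₁ (x 0) (x 1) (x 2) (x 3) ^ 2 ∂(momentMeasure lam₄ W) :=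
      integral_nonneg fun _ => sq_nonneg _
    linarith
  · have a := integral_momentMeasure_le h₃' hM₃ hW j3 fun _ => sq_nonneg _
    have b := mul_le_mul_of_nonneg_left (integral_signCov_sq_le P hmeas (k := 3) 0 1 0 2 hW) h₃'
    have c := integral_momentMeasure_le h₄' hM₄ hW j4 fun _ => sq_nonneg _
    have d := mul_le_mul_of_nonneg_left (hZ₁.integral_signCov_sq_four_le hmeas hR hW) h₄'
    linarith
  · have a := le_integral_momentMeasure h₂ hm₂ hM₂ hW j2 fun _ => sq_nonneg _
    rw [hZ₁.integral_signCov_sq_two hR h0 hW] at a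
    linarith
  · have a := integral_momentMeasure_le h₂' hM₂ hW j2 fun _ => sq_nonneg _
    rw [hZ₁.integral_signCov_sq_two hR h0 hW] at a
    linarith

/-- The variance of the first-order approximation of `S / U` for centred `S`. -/
theorem variance_taylorRatio {Ω : Type*} [MeasurableSpace Ω] (P : Measure Ω) {S U : Ω → ℝ}
    (hS : P[S] = 0) (hU : P[U] ≠ 0) :
    Var[taylorRatio P S U; P] = Var[S; P] / P[U] ^ 2 := by
  -- The derivative of `s / u` in `u` is `-s / u ^ 2`, which vanishes at `s = P[S] = 0`, so `U`
  -- drops out.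
  have hT : taylorRatio P S U = fun ω => (P[U])⁻¹ * S ω := by
    funext ω
    have hinv := (hasDerivAt_inv hU).comp_hasFDerivAt (P[S], P[U])
      (hasFDerivAt_snd (𝕜 := ℝ) (E := ℝ) (F := ℝ) (p := (P[S], P[U])))
    have hd := (hasFDerivAt_fst (𝕜 := ℝ) (E := ℝ) (F := ℝ) (p := (P[S], P[U]))).fun_mul hinv
    simp only [Function.comp_apply, ← div_eq_mul_inv] at hd
    rw [taylorRatio, hd.fderiv, hS]
    simp
  rw [hT, variance_const_mul, inv_pow, div_eq_inv_mul]

theorem theorem2 {Ω : Type*} [MeasurableSpace Ω] (P : Measure Ω) [IsProbabilityMeasure P]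
    (Ψ : Ω → Set (Plane × ℝ)) (Φ : Ω → Set Plane) (Z₁ Z₂ : Plane → Ω → ℝ)
    (hΨ : IsStationaryMarkedPointProcess P Ψ)
    (hmark : FollowsGeostatisticalMarking Ψ Φ Z₁)
    (hindep : AreIndependent P Φ Z₁ Z₂)
    (lam : ℝ) (hlam_pos : 0 < lam) (hlam : IsProductDensity P Φ 1 (fun _ => lam))
    (lam₂ : (Fin 2 → Plane) → ℝ) (hlam₂ : IsProductDensity P Φ 2 lam₂)
    (hlam₂_bdd : IsBoundedAboveBelow lam₂)
    (lam₃ : (Fin 3 → Plane) → ℝ) (hlam₃ : IsProductDensity P Φ 3 lam₃)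
    (hlam₃_bdd : IsBoundedAboveBelow lam₃)
    (lam₄ : (Fin 4 → Plane) → ℝ) (hlam₄ : IsProductDensity P Φ 4 lam₄)
    (hlam₄_bdd : IsBoundedAboveBelow lam₄)
    (C : Plane → ℝ)
    (hZ₁ : IsCentredStationaryGaussianField P Z₁ C)
    (hZ₂ : IsCentredStationaryGaussianField P Z₂ C)
    (hC_nonneg : ∀ h, 0 ≤ C h)
    (R : ℝ) (hC_range : ∀ h, R < ‖h‖ → C h = 0)
    (δ r : ℝ) (hδ : 0 < δ) (hr : 0 < r) (hC_near : ∀ h, ‖h‖ ≤ r → δ ≤ C h) :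
    (∃ c₁ c₂ d₁ d₂ u₁ u₂ : ℝ,
      0 < c₁ ∧ c₁ ≤ c₂ ∧ 0 < d₁ ∧ d₁ ≤ d₂ ∧ 0 < u₁ ∧ u₁ ≤ u₂ ∧
      ∀ W : Set Plane, IsCompact W → 0 < area W →
        -- the moments in question exist
        MemLp (kendallSum Φ Z₁ Z₂ W) 2 P ∧ Integrable (pairCount Φ W) P ∧
        -- the decomposition of the variance of `S`
        (∃ A B : ℝ, Var[kendallSum Φ Z₁ Z₂ W; P] = A + B ∧
          c₁ ≤ A / (lam ^ 3 * area W ^ 3) ∧ A / (lam ^ 3 * area W ^ 3) ≤ c₂ ∧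
          d₁ ≤ B / (lam ^ 2 * area W ^ 2) ∧ B / (lam ^ 2 * area W ^ 2) ≤ d₂) ∧
        -- the order of the mean of `U`
        u₁ ≤ P[pairCount Φ W] / (lam * area W) ^ 2 ∧
        P[pairCount Φ W] / (lam * area W) ^ 2 ≤ u₂ ∧
        -- the first-order approximation of the variance of `S / U`
        Var[taylorRatio P (kendallSum Φ Z₁ Z₂ W) (pairCount Φ W); P] =
          Var[kendallSum Φ Z₁ Z₂ W; P] / P[pairCount Φ W] ^ 2) ∧
    -- the approximate variance of `S / U` is of order `1 / (λ |W|)`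
    (∀ w₀ : ℝ, 0 < w₀ → ∃ v₁ v₂ : ℝ, 0 < v₁ ∧ v₁ ≤ v₂ ∧
      ∀ W : Set Plane, IsCompact W → w₀ ≤ area W →
        v₁ / (lam * area W) ≤
          Var[taylorRatio P (kendallSum Φ Z₁ Z₂ W) (pairCount Φ W); P] ∧
        Var[taylorRatio P (kendallSum Φ Z₁ Z₂ W) (pairCount Φ W); P] ≤
          v₂ / (lam * area W)) := by 
  obtain ⟨m₂, M₂, hm₂, hmM₂, h₂, h₂'⟩ := hlam₂_bdd.exists_bounds
  obtain ⟨m₃, M₃, hm₃, hmM₃, h₃, h₃'⟩ := hlam₃_bdd.exists_bounds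
  obtain ⟨m₄, M₄, hm₄, hmM₄, h₄, h₄'⟩ := hlam₄_bdd.exists_bounds
  have hM₂ := hm₂.trans_le hmM₂
  have hM₃ := hm₃.trans_le hmM₃
  have hM₄ := hm₄.trans_le hmM₄
  -- Non-degeneracy of the field, which rules out ties.
  have hC0 : C 0 ≠ 0 := (hδ.trans_le (hC_near 0 (by rw [norm_zero]; exact hr.le))).ne'
  have hlf : ∀ ω, IsLocallyFinite (Φ ω) := fun ω => by
    rw [(hmark ω).1]; exact hΨ.locallyFinite ω
  have key := fun (W : Set Plane) (hW : IsCompact W) => kendall_moments P hlf hindep hlam₂ hlam₃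
    hlam₄ hm₂.le hM₂.le hm₃.le hM₃.le hM₄.le h₂ h₂' h₃ h₃' h₄' hZ₁ hZ₂ hC_range hC0 hW
  set V := volume.real (Metric.closedBall (0 : Plane) R)
  have hV : 0 ≤ V := measureReal_nonneg
  have hU0 : ∀ W, IsCompact W → 0 < area W → 0 < P[pairCount Φ W] := fun W hW ha =>
    lt_of_lt_of_le (by positivity) (key W hW).2.2.2.1.1
  have htaylor := fun (W : Set Plane) (hW : IsCompact W) (ha : 0 < area W) =>
    variance_taylorRatio P (key W hW).2.2.1 (hU0 W hW ha).ne'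
  constructor
  · refine ⟨4 * m₃ / (9 * lam ^ 3), (4 * M₄ * V + 4 * M₃) / lam ^ 3, 2 * m₂ / lam ^ 2,
      2 * M₂ / lam ^ 2, m₂ / lam ^ 2, M₂ / lam ^ 2, by positivity, ?_, by positivity, by gcongr,
      by positivity, by gcongr, fun W hW ha => ?_⟩
    · rw [div_le_div_iff₀ (by positivity) (by positivity)]
      have : 0 ≤ M₄ * V := by positivity
      nlinarith [pow_pos hlam_pos 3]
    obtain ⟨hmem, hint, -, ⟨u1, u2⟩, A, B, hvar, a1, a2, b1, b2⟩ := key W hW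
    refine ⟨hmem, hint, ⟨A, B, hvar, ?_, ?_, ?_, ?_⟩, ?_, ?_, htaylor W hW ha⟩
    · rw [div_le_div_iff₀ (by positivity) (by positivity)]
      nlinarith [pow_pos hlam_pos 3]
    · rw [div_le_div_iff₀ (by positivity) (by positivity)]
      nlinarith [pow_pos hlam_pos 3]
    · rw [div_le_div_iff₀ (by positivity) (by positivity)]
      nlinarith [pow_pos hlam_pos 2]
    · rw [div_le_div_iff₀ (by positivity) (by positivity)]
      nlinarith [pow_pos hlam_pos 2]
    · rw [div_le_div_iff₀ (by positivity) (by positivity)]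
      nlinarith [pow_pos hlam_pos 2]
    · rw [div_le_div_iff₀ (by positivity) (by positivity)]
      nlinarith [pow_pos hlam_pos 2]
  · intro w₀ hw₀
    -- The last summand absorbs the pair term: `|W| ^ 2 ≤ |W| ^ 3 / w₀` when `w₀ ≤ |W|`.
    set K := M₄ * (4 * V) + 4 * M₃ + 2 * M₂ / w₀
    have hK : 0 < K := by positivity
    -- The lower bound of the variance over the square of the upper bound of `𝔼 U`; `v'` pairs the
    -- opposite bounds. The maximum taken next makes the required order of the two constants
    -- immediate.
    set v := 4 * m₃ / 9 * lam / M₂ ^ 2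
    set v' := K * lam / m₂ ^ 2
    refine ⟨v, max v v', by positivity, le_max_left _ _, fun W hW hw => ?_⟩
    have ha : 0 < area W := hw₀.trans_le hw
    rw [htaylor W hW ha]
    obtain ⟨-, -, -, ⟨u1, u2⟩, A, B, hvar, a1, a2, b1, b2⟩ := key W hW
    have hU := hU0 W hW ha
    set b := area W
    have hB : 0 ≤ B := le_trans (by positivity) b1
    have hlow : 4 * m₃ / 9 * b ^ 3 ≤ Var[kendallSum Φ Z₁ Z₂ W; P] := by rw [hvar]; linarith
    have hupp : Var[kendallSum Φ Z₁ Z₂ W; P] ≤ K * b ^ 3 := by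
      have : 2 * (M₂ * b ^ 2) ≤ 2 * M₂ / w₀ * b ^ 3 := by
        rw [div_mul_eq_mul_div, le_div_iff₀ hw₀]
        have := mul_le_mul_of_nonneg_left hw (by positivity : 0 ≤ 2 * M₂ * b ^ 2)
        linarith
      rw [hvar]
      simp only [K]
      linarith
    constructor
    · calc v / (lam * b) = (4 * m₃ / 9 * b ^ 3) / (M₂ * b ^ 2) ^ 2 := by
            simp only [v]; field_simp
        _ ≤ Var[kendallSum Φ Z₁ Z₂ W; P] / P[pairCount Φ W] ^ 2 := by
            gcongr
            exact variance_nonneg _ _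
    · calc Var[kendallSum Φ Z₁ Z₂ W; P] / P[pairCount Φ W] ^ 2 ≤
            (K * b ^ 3) / (m₂ * b ^ 2) ^ 2 := by gcongr
        _ = v' / (lam * b) := by simp only [v']; field_simp
        _ ≤ max v v' / (lam * b) := by
            gcongr
            exact le_max_right _ _
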